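/- Let $R$ be a commutative ring in which $2$ is invertible (for example $R=\mathbb{Q}$). Let $\mathrm{Cob}_{/l}$ be the following category. Its objects are finite disjoint unions of circles. Its morphisms are the $R$-linear combinations of compact orientable (abstract) surfaces with incoming and outgoing boundary, up to homeomorphism relative to the boundary, composed by gluing, modulo the two-sided ideal generated by the local relations S (a surface with an additional sphere component is $0$), T (an additional torus component multiplies by $2$) and 4Tu ($C_{12}+C_{34}=C_{13}+C_{24}$, where $C_{ij}$ is a given surface with a tube added between the $i$-th and the $j$-th of four given sites). Let $\mathrm{Mat}(\mathrm{Cob}_{/l})$ be its additive closure. For a diagram $D$ of an oriented link, let $[\![D]\!]$ be the geometric complex of $D$: the cochain complex over $\mathrm{Mat}(\mathrm{Cob}_{/l})$ given by the cube of resolutions of $D$, with signed saddles as its differentials and with the smoothings having $k$ $1$-smoothings in degree $k-n_-$, where $n_-$ is the number of negative crossings. Let $A_T=R[T][X]/(X^2-T)$ with $v_+=1$, $v_-=X$, counit $\epsilon(v_+)=0$, $\epsilon(v_-)=1$, multiplication as in the ring $A_T$ and comultiplication $\Delta(v_+)=v_+\otimes v_-+v_-\otimes v_+$, $\Delta(v_-)=v_-\otimes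 v_-+T\,v_+\otimes v_+$. Let $\mathcal{F}_T$ be the TQFT of this Frobenius algebra, which satisfies the local relations, regarded as an additive functor from $\mathrm{Mat}(\mathrm{Cob}_{/l})$ to the category $\mathrm{Free}(R[T])$ of free $R[T]$-modules of finite rank. **Theorem.** Let $\mathcal{A}$ be a preadditive category and $F:\mathrm{Mat}(\mathrm{Cob}_{/l})\to\mathcal{A}$ an additive functor. Then there is an additive functor $G:\mathrm{Free}(R[T])\to\mathcal{A}$ such that: 1. $G\circ\mathcal{F}_T\cong F$, and every functor $G'$ with $G'\circ\mathcal{F}_T\cong F$ is isomorphic to $G$; 2. $F([\![D]\!])\cong G(\mathcal{F}_T([\![D]\!]))$ as cochain complexes for every link diagram $D$; 3. for all link diagrams $D$, $D'$, if $\mathcal{F}_T([\![D]\!])$ and $\mathcal{F}_T([\![D']\!])$ are homotopy equivalent, then so are $F([\![D]\!])$ and $F([\![D']\!])$. So every functor used to create a link homology theory from the geometric complex factors through $\mathcal{F}_T$, and $\mathcal{F}_T$ is the universal link homology theory when $2$ is invertible and holds the maximum amount of information. -/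

import Mathlib

open CategoryTheory Polynomial TensorProduct

universe u v w

noncomputable section

namespace GeomLink

/-! ## Surfaces with boundary -/

open Classical in
/-- The sum of the weights `w v` over the fibre of `f` over `k`. -/
noncomputable def fibSum {V K : Type} [Fintype V] (f : V → K) (w : V → ℕ) (k : K) : ℕ :=
  ∑ v with f v = k, w v

/-- The classes of `V` under the equivalence relation generated by `s e ∼ t e`, `e : E`. If `V` is
the set of connected components of a surface, and a circle of the component `s e` is glued to
a circle of the component `t e` for each `e : E`, this is the set of connected components of
the result. -/
def Glued {V E : Type} (s t : E → V) : Type := Quot fun v w => ∃ e, s e = v ∧ t e = w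

/-- The class of `v`. -/
def Glued.mk {V E : Type} (s t : E → V) (v : V) : Glued s t := Quot.mk _ v

noncomputable instance {V E : Type} [Fintype V] (s t : E → V) : Fintype (Glued s t) :=
  @Fintype.ofFinite _ (Quot.finite _)

/-- The genus of a component of a glued surface: the sum of the genera of its pieces,
plus the first Betti number `#gluings + 1 - #pieces` of the gluing pattern
(the natural subtraction never truncates, as the pattern is connected). -/
noncomputable def gluedGenus {V E : Type} [Fintype V] [Fintype E] (s t : E → V) (g : V → ℕ)
    (c : Glued s t) : ℕ :=
  fibSum (Glued.mk s t) g c + fibSum (fun e => Glued.mk s t (s e)) 1 c + 1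
    - fibSum (Glued.mk s t) 1 c

theorem fibSum_comp {V K L : Type} [Fintype V] [Fintype K] (f : V → K) (h : K → L)
    (w : V → ℕ) (l : L) : fibSum h (fibSum f w) l = fibSum (fun v => h (f v)) w l := by
  classical
  unfold fibSum
  rw [← Finset.sum_fiberwise_of_maps_to (s := Finset.univ.filter fun v => h (f v) = l)
    (t := Finset.univ.filter fun k => h k = l) (g := f) (by simp) w]
  refine Finset.sum_congr (by ext; simp) fun k hk => Finset.sum_congr ?_ fun _ _ => rfl
  ext v
  simp only [Finset.mem_filter, Finset.mem_univ, true_and] at hk ⊢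
  constructor
  · rintro rfl; exact ⟨hk, rfl⟩
  · exact fun h => h.2

theorem fibSum_congr {V K : Type} [Fintype V] (f : V → K) {w w' : V → ℕ} (k : K)
    (h : ∀ v, f v = k → w v = w' v) : fibSum f w k = fibSum f w' k := by
  classical
  exact Finset.sum_congr rfl fun v hv => h v (by simpa using hv)

theorem fibSum_add {V K : Type} [Fintype V] (f : V → K) (w w' : V → ℕ) (k : K) :
    fibSum f (w + w') k = fibSum f w k + fibSum f w' k := by
  classical
  exact Finset.sum_add_distrib

theorem fibSum_sum {V W K : Type} [Fintype V] [Fintype W] (f : V ⊕ W → K) (w : V ⊕ W → ℕ) (k : K) :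
    fibSum f w k = fibSum (fun v => f (.inl v)) (fun v => w (.inl v)) k
      + fibSum (fun v => f (.inr v)) (fun v => w (.inr v)) k := by
  classical
  simp only [fibSum, Finset.sum_filter, Fintype.sum_sum_type]

theorem fibSum_equiv {V W K : Type} [Fintype V] [Fintype W] (φ : W ≃ V) (f : V → K)
    (w : V → ℕ) (k : K) : fibSum (fun v => f (φ v)) (fun v => w (φ v)) k = fibSum f w k := by
  classical
  simp only [fibSum, Finset.sum_filter]
  exact Equiv.sum_comp φ fun v => if f v = k then w v else 0

theorem fibSum_inj {V K : Type} [Fintype V] (f : V → K) (hf : Function.Injective f)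
    (w : V → ℕ) (v : V) : fibSum f w (f v) = w v := by
  classical
  simp [fibSum, Finset.sum_filter, hf.eq_iff]

/-- `f : V → K` exhibits `K`, with genera `γ`, as the components of the surface glued from
the pieces `V`, with genera `g`, along `s`, `t`. -/
structure IsGlue {V E K : Type} [Fintype V] [Fintype E] (s t : E → V) (g : V → ℕ) (f : V → K)
    (γ : K → ℕ) : Prop where
  surj : Function.Surjective f
  eq : ∀ e, f (s e) = f (t e)
  lift : ∀ h : V → Prop, (∀ e, h (s e) ↔ h (t e)) → ∀ v w, f v = f w → (h v → h w)
  genus : ∀ k, γ k + fibSum f 1 k = fibSum f g k + fibSum (fun e => f (s e)) 1 k + 1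

theorem glued_lift {V E : Type} (s t : E → V) (h : V → Prop) (hh : ∀ e, h (s e) ↔ h (t e))
    (v w : V) (hvw : Glued.mk s t v = Glued.mk s t w) : h v ↔ h w := by
  have : Quot.lift h (fun a b ⟨e, ha, hb⟩ => propext (by subst ha; subst hb; exact hh e))
      (Glued.mk s t v) = Quot.lift h (fun a b ⟨e, ha, hb⟩ => propext
      (by subst ha; subst hb; exact hh e)) (Glued.mk s t w) := by rw [hvw]
  exact iff_of_eq this

theorem card_le_glued {V E : Type} [Fintype V] [Fintype E] (s t : E → V) (c : Glued s t) :
    fibSum (Glued.mk s t) 1 c ≤ fibSum (fun e => Glued.mk s t (s e)) 1 c + 1 := by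
  classical
  have hst : ∀ e, Glued.mk s t (s e) = Glued.mk s t (t e) := fun e => Quot.sound ⟨e, rfl, rfl⟩
  let P := {v // Glued.mk s t v = c}
  let Q := {e // Glued.mk s t (s e) = c}
  let a : Q → P := fun e => ⟨s e.1, e.2⟩
  let b : Q → P := fun e => ⟨t e.1, (hst e.1).symm.trans e.2⟩
  let G : SimpleGraph P := SimpleGraph.fromRel fun v w => ∃ e, a e = v ∧ b e = w
  have hG : G.Connected := by
    obtain ⟨v₀, hv₀⟩ : ∃ v, Glued.mk s t v = c := Quot.exists_rep c
    have key : ∀ w : P, G.Reachable ⟨v₀, hv₀⟩ w := by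
      rintro ⟨w, hw⟩
      let h : V → Prop := fun v => ∀ hv : Glued.mk s t v = c, G.Reachable ⟨v₀, hv₀⟩ ⟨v, hv⟩
      have hh : ∀ e, h (s e) ↔ h (t e) := by
        intro e
        by_cases he : Glued.mk s t (s e) = c
        · have hr : G.Reachable (a ⟨e, he⟩) (b ⟨e, he⟩) := by
            by_cases hab : a ⟨e, he⟩ = b ⟨e, he⟩
            · rw [hab]
            · exact SimpleGraph.Adj.reachable
                ((SimpleGraph.fromRel_adj _ _ _).2 ⟨hab, Or.inl ⟨_, rfl, rfl⟩⟩)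
          exact ⟨fun H hv => (H he).trans hr, fun H hv => (H (b ⟨e, he⟩).2).trans hr.symm⟩
        · exact ⟨fun _ hv => absurd ((hst e).trans hv) he, fun _ hv => absurd hv he⟩
      exact (glued_lift s t h hh v₀ w (hv₀.trans hw.symm)).1 (fun hv => .refl _) hw
    exact (SimpleGraph.connected_iff_exists_forall_reachable G).2 ⟨_, key⟩
  have h1 := hG.card_vert_le_card_edgeSet_add_one
  have h2 : Nat.card G.edgeSet ≤ Nat.card Q := by
    have : ∀ x : G.edgeSet, ∃ e : Q, s(a e, b e) = x.1 := by
      rintro ⟨x, hx⟩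
      induction x using Sym2.ind with
      | _ v w =>
        rw [SimpleGraph.mem_edgeSet, SimpleGraph.fromRel_adj] at hx
        rcases hx.2 with ⟨e, rfl, rfl⟩ | ⟨e, rfl, rfl⟩
        · exact ⟨e, rfl⟩
        · exact ⟨e, Sym2.eq_swap⟩
    choose r hr using this
    refine Nat.card_le_card_of_injective r fun x y hxy => Subtype.ext ?_
    rw [← hr x, ← hr y, hxy]
  have e1 : Nat.card P = fibSum (Glued.mk s t) 1 c := by
    simp [P, fibSum, Fintype.card_subtype]
  have e2 : Nat.card Q = fibSum (fun e => Glued.mk s t (s e)) 1 c := by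
    simp [Q, fibSum, Fintype.card_subtype]
  omega

theorem isGlue_glued {V E : Type} [Fintype V] [Fintype E] (s t : E → V) (g : V → ℕ) :
    IsGlue s t g (Glued.mk s t) (gluedGenus s t g) where
  surj := Quot.exists_rep
  eq e := Quot.sound ⟨e, rfl, rfl⟩
  lift h hh v w hvw := (glued_lift s t h hh v w hvw).1
  genus k := by
    have := card_le_glued s t k
    unfold gluedGenus
    omega

namespace IsGlue

variable {V E K : Type} [Fintype V] [Fintype E] {s t : E → V} {g : V → ℕ} {f : V → K} {γ : K → ℕ}

/-- A gluing is unique up to a unique bijection. -/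
theorem unique (H : IsGlue s t g f γ) {K' : Type} {f' : V → K'} {γ' : K' → ℕ}
    (H' : IsGlue s t g f' γ') :
    ∃ φ : K ≃ K', (∀ v, φ (f v) = f' v) ∧ ∀ k, γ' (φ k) = γ k := by
  have h1 : ∀ v w, f v = f w ↔ f' v = f' w := fun v w =>
    ⟨fun h => (H.lift (fun x => f' v = f' x) (fun e => by rw [H'.eq e]) v w h rfl),
     fun h => (H'.lift (fun x => f v = f x) (fun e => by rw [H.eq e]) v w h rfl)⟩
  let φ : K ≃ K' :=
    { toFun := fun k => f' (H.surj k).choose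
      invFun := fun k => f (H'.surj k).choose
      left_inv := fun k => by
        have a := (H'.surj (f' (H.surj k).choose)).choose_spec
        rw [← h1] at a
        exact a.trans (H.surj k).choose_spec
      right_inv := fun k => by
        have a := (H.surj (f (H'.surj k).choose)).choose_spec
        rw [h1] at a
        exact a.trans (H'.surj k).choose_spec }
  have hφ : ∀ v, φ (f v) = f' v := fun v => (h1 _ _).1 (H.surj (f v)).choose_spec
  refine ⟨φ, hφ, fun k => ?_⟩
  have e : ∀ {X : Type} [Fintype X] (p : X → V) (w : X → ℕ),
      fibSum (fun x => f' (p x)) w (φ k) = fibSum (fun x => f (p x)) w k := by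
    classical
    intro X _ p w
    simp only [fibSum, ← hφ, φ.injective.eq_iff]
  have a := H.genus k
  have b := H'.genus (φ k)
  have e1 : fibSum f' 1 (φ k) = fibSum f 1 k := e (fun v => v) 1
  have e2 : fibSum f' g (φ k) = fibSum f g k := e (fun v => v) g
  have e3 := e s 1
  omega

/-- Gluing in two stages. -/
theorem trans [Fintype K] (H : IsGlue s t g f γ) {E' L : Type} [Fintype E'] {s' t' : E' → V}
    {f' : K → L} {δ : L → ℕ}
    (H' : IsGlue (fun e => f (s' e)) (fun e => f (t' e)) γ f' δ) :
    IsGlue (Sum.elim s s') (Sum.elim t t') g (fun v => f' (f v)) δ where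
  surj := H'.surj.comp H.surj
  eq := by
    rintro (e | e)
    · exact congrArg f' (H.eq e)
    · exact H'.eq e
  lift h hh v w hvw hv := by
    have hd : ∀ x y, f x = f y → h x → h y := H.lift h fun e => hh (.inl e)
    obtain ⟨y, hy, hy'⟩ := H'.lift (fun k => ∃ x, f x = k ∧ h x) (fun e => by
      constructor
      · rintro ⟨x, hx, hx'⟩; exact ⟨t' e, rfl, (hh (.inr e)).1 (hd _ _ hx hx')⟩
      · rintro ⟨x, hx, hx'⟩; exact ⟨s' e, rfl, (hh (.inr e)).2 (hd _ _ hx hx')⟩) _ _ hvw ⟨v, rfl, hv⟩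
    exact hd _ _ hy hy'
  genus l := by
    have a := H'.genus l
    have b : fibSum f' (γ + fibSum f 1) l =
        fibSum f' (fibSum f g + fibSum (fun e => f (s e)) 1 + 1) l :=
      fibSum_congr _ _ fun k _ => H.genus k
    simp only [fibSum_add, fibSum_comp] at b
    rw [fibSum_sum]
    simp only [Sum.elim_inl, Sum.elim_inr]
    change _ = _ + (fibSum (fun e => f' (f (s e))) 1 l + fibSum (fun e => f' (f (s' e))) 1 l) + 1
    omega

/-- Leaving further pieces unglued. -/
theorem sum_right (H : IsGlue s t g f γ) {W : Type} [Fintype W] (g' : W → ℕ) :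
    IsGlue (fun e => (Sum.inl (s e) : V ⊕ W)) (fun e => Sum.inl (t e)) (Sum.elim g g')
      (Sum.map f id) (Sum.elim γ g') where
  surj := H.surj.sumMap Function.surjective_id
  eq e := congrArg Sum.inl (H.eq e)
  lift h hh v w hvw := by
    rcases v with v | v <;> rcases w with w | w <;>
      simp only [Sum.map_inl, Sum.map_inr, Sum.inl.injEq, Sum.inr.injEq, id, reduceCtorEq] at hvw
    · exact H.lift (fun v => h (.inl v)) hh v w hvw
    · rw [hvw]; exact id
  genus k := by
    have z1 : ∀ {X : Type} [Fintype X] (p : X → K) (q : X → ℕ) (x : W),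
        fibSum (fun e => (Sum.inl (p e) : K ⊕ W)) q (.inr x) = 0 := by
      classical intros; simp [fibSum]
    have z2 : ∀ (q : W → ℕ) (x : K),
        fibSum (fun e => (Sum.inr e : K ⊕ W)) q (.inl x) = 0 := by
      classical intros; simp [fibSum]
    have z3 : ∀ {X : Type} [Fintype X] (p : X → K) (q : X → ℕ) (x : K),
        fibSum (fun e => (Sum.inl (p e) : K ⊕ W)) q (.inl x) = fibSum p q x := by
      classical intros; simp [fibSum]
    have z4 : ∀ (q : W → ℕ) (x : W),
        fibSum (fun e => (Sum.inr e : K ⊕ W)) q (.inr x) = q x :=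
      fun q x => fibSum_inj Sum.inr Sum.inr_injective q x
    rw [fibSum_sum, fibSum_sum]
    rcases k with k | k <;>
      simp only [Sum.map_inl, Sum.map_inr, Sum.elim_inl, Sum.elim_inr, id, Pi.one_apply]
    · have := H.genus k
      rw [z3 (fun e => f (s e)), z3 f, z3 f, z2, z2]
      exact this
    · rw [z1, z1, z1, z4, z4]; omega

/-- Renaming the pieces and the gluings. -/
theorem congr {V' E' : Type} [Fintype V'] [Fintype E'] (φ : V' ≃ V) (ψ : E' ≃ E)
    {s' t' : E' → V'} (hs : ∀ e, φ (s' e) = s (ψ e)) (ht : ∀ e, φ (t' e) = t (ψ e))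
    {g' : V' → ℕ} (hg : ∀ v, g' v = g (φ v)) (H : IsGlue s t g f γ) :
    IsGlue s' t' g' (fun v => f (φ v)) γ where
  surj := H.surj.comp φ.surjective
  eq e := by rw [hs, ht, H.eq]
  lift h hh v w hvw hv := by
    have := H.lift (fun x => h (φ.symm x)) (fun e => by
      obtain ⟨e, rfl⟩ := ψ.surjective e
      rw [← hs, ← ht, φ.symm_apply_apply, φ.symm_apply_apply]; exact hh e) _ _ hvw
    simpa using this (by simpa using hv)
  genus k := by
    have a := H.genus k
    have e1 := fibSum_equiv φ f 1 k
    have e2 := fibSum_equiv φ f g k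
    have e3 := fibSum_equiv ψ (fun e => f (s e)) 1 k
    have e4 : g' = fun v => g (φ v) := funext hg
    simp only [hs, e4]
    change _ + fibSum (fun v => f (φ v)) 1 k = _ + fibSum (fun e => f (s (ψ e))) 1 k + 1
    change fibSum (fun v => f (φ v)) 1 k = _ at e1
    change fibSum (fun e => f (s (ψ e))) 1 k = _ at e3
    omega

end IsGlue


/-- A compact oriented surface whose boundary is identified with the disjoint union of the
circles `I` (incoming) and `J` (outgoing), up to homeomorphism: a finite set of connected
components, the component on which each boundary circle lies, and the genus of each component. -/
structure Surface (I J : Type) where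
  Comp : Type
  [fintype : Fintype Comp]
  src : I → Comp
  tgt : J → Comp
  genus : Comp → ℕ

attribute [instance] Surface.fintype

namespace Surface

variable {I J K L : Type}

/-- Homeomorphism relative to the boundary. -/
def Homeo (S S' : Surface I J) : Prop :=
  ∃ φ : S.Comp ≃ S'.Comp, (∀ i, φ (S.src i) = S'.src i) ∧ (∀ j, φ (S.tgt j) = S'.tgt j) ∧
    ∀ c, S'.genus (φ c) = S.genus c

/-- The cylinder on `I`. -/
def cyl (I : Type) [Fintype I] : Surface I I where
  Comp := I
  src := id
  tgt := id
  genus _ := 0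

/-- Gluing along the circles `J`. -/
noncomputable def glue [Fintype J] (S : Surface I J) (S' : Surface J K) : Surface I K where
  Comp := Glued (V := S.Comp ⊕ S'.Comp) (fun j => .inl (S.tgt j)) (fun j => .inr (S'.src j))
  src i := Glued.mk _ _ (.inl (S.src i))
  tgt k := Glued.mk _ _ (.inr (S'.tgt k))
  genus := gluedGenus _ _ (Sum.elim S.genus S'.genus)

/-- `S` with a tube added, joining a point of the component `a` to a point of the component `b`. -/
noncomputable def tube (S : Surface I J) (a b : S.Comp) : Surface I J where
  Comp := Glued (fun _ : Unit => a) (fun _ => b)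
  src i := Glued.mk _ _ (S.src i)
  tgt j := Glued.mk _ _ (S.tgt j)
  genus := gluedGenus _ _ S.genus

/-- The disjoint union of `S` and a closed connected surface of genus `g`. -/
def addClosed (S : Surface I J) (g : ℕ) : Surface I J where
  Comp := Option S.Comp
  src i := some (S.src i)
  tgt j := some (S.tgt j)
  genus c := c.elim g S.genus

theorem homeo_equivalence : Equivalence (Homeo (I := I) (J := J)) where
  refl S := ⟨Equiv.refl _, fun _ => rfl, fun _ => rfl, fun _ => rfl⟩
  symm := by
    rintro S S' ⟨φ, h1, h2, h3⟩
    exact ⟨φ.symm, fun i => by simp [← h1], fun i => by simp [← h2], fun c => by simp [← h3]⟩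
  trans := by
    rintro S S' S'' ⟨φ, h1, h2, h3⟩ ⟨φ', h1', h2', h3'⟩
    exact ⟨φ.trans φ', by simp [h1, h1'], by simp [h2, h2'], by simp [h3, h3']⟩

instance setoid (I J : Type) : Setoid (Surface I J) := ⟨Homeo, homeo_equivalence⟩

/-- Recognizing a glued surface. -/
theorem glue_homeo [Fintype J] (S : Surface I J) (S' : Surface J K) (S'' : Surface I K)
    (f : S.Comp ⊕ S'.Comp → S''.Comp)
    (H : IsGlue (fun j => .inl (S.tgt j)) (fun j => .inr (S'.src j))
      (Sum.elim S.genus S'.genus) f S''.genus)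
    (h1 : ∀ i, f (.inl (S.src i)) = S''.src i) (h2 : ∀ k, f (.inr (S'.tgt k)) = S''.tgt k) :
    Homeo (S.glue S') S'' := by
  obtain ⟨φ, h, h'⟩ := (isGlue_glued (V := S.Comp ⊕ S'.Comp) (fun j => .inl (S.tgt j))
    (fun j => .inr (S'.src j)) (Sum.elim S.genus S'.genus)).unique H
  exact ⟨φ, fun i => (h _).trans (h1 i), fun k => (h _).trans (h2 k), h'⟩

theorem isGlue_glue [Fintype J] (S : Surface I J) (S' : Surface J K) :
    IsGlue (fun j => .inl (S.tgt j)) (fun j => .inr (S'.src j)) (Sum.elim S.genus S'.genus)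
      (Glued.mk _ _) (S.glue S').genus :=
  isGlue_glued _ _ _

theorem glue_congr [Fintype J] {S T : Surface I J} {S' T' : Surface J K} (h : Homeo S T)
    (h' : Homeo S' T') : Homeo (S.glue S') (T.glue T') := by
  obtain ⟨φ, h1, h2, h3⟩ := h
  obtain ⟨ψ, k1, k2, k3⟩ := h'
  refine glue_homeo S S' (T.glue T') (fun v => Glued.mk _ _ (Equiv.sumCongr φ ψ v)) ?_
    (fun i => by simp [h1, glue]) (fun k => by simp [k2, glue])
  exact IsGlue.congr (Equiv.sumCongr φ ψ) (Equiv.refl J) (by simp [h2]) (by simp [k1])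
    (by rintro (v | v) <;> simp [h3, k3]) (isGlue_glue T T')

theorem cyl_glue [Fintype I] (S : Surface I J) : Homeo ((cyl I).glue S) S := by
  refine glue_homeo _ _ _ (Sum.elim S.src id) ⟨fun c => ⟨.inr c, rfl⟩, fun _ => rfl, ?_, ?_⟩
    (fun _ => rfl) (fun _ => rfl)
  · intro h hh
    have key : ∀ v, h v ↔ h (.inr (Sum.elim S.src id v)) := by
      rintro (v | v)
      · exact hh v
      · rfl
    intro v w hvw hv
    exact (key w).2 (hvw ▸ (key v).1 hv)
  · intro c
    have e1 := fibSum_inj (id : S.Comp → S.Comp) Function.injective_id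
    have e2 : fibSum S.src (cyl I).genus c = 0 := by
      classical exact Finset.sum_eq_zero fun _ _ => rfl
    rw [fibSum_sum, fibSum_sum]
    have := e1 1 c
    have := e1 S.genus c
    simp only [id] at this
    change S.genus c + (fibSum S.src 1 c + fibSum id 1 c) =
      (fibSum S.src (cyl I).genus c + fibSum id S.genus c) + fibSum S.src 1 c + 1
    simp only [id, Pi.one_apply] at *
    omega

theorem glue_cyl [Fintype J] (S : Surface I J) : Homeo (S.glue (cyl J)) S := by
  refine glue_homeo _ _ _ (Sum.elim id S.tgt) ⟨fun c => ⟨.inl c, rfl⟩, fun _ => rfl, ?_, ?_⟩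
    (fun _ => rfl) (fun _ => rfl)
  · intro h hh
    have key : ∀ v, h v ↔ h (.inl (Sum.elim id S.tgt v)) := by
      rintro (v | v)
      · rfl
      · exact (hh v).symm
    intro v w hvw hv
    exact (key w).2 (hvw ▸ (key v).1 hv)
  · intro c
    have e1 := fibSum_inj (id : S.Comp → S.Comp) Function.injective_id
    have e2 : fibSum S.tgt (cyl J).genus c = 0 := by
      classical exact Finset.sum_eq_zero fun _ _ => rfl
    rw [fibSum_sum, fibSum_sum]
    have := e1 1 c
    have := e1 S.genus c
    simp only [id] at this
    change S.genus c + (fibSum id 1 c + fibSum S.tgt 1 c) =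
      (fibSum id S.genus c + fibSum S.tgt (cyl J).genus c) + fibSum S.tgt 1 c + 1
    simp only [id, Pi.one_apply] at *
    omega

theorem glue_assoc [Fintype J] [Fintype K] (S : Surface I J) (S' : Surface J K)
    (S'' : Surface K L) : Homeo ((S.glue S').glue S'') (S.glue (S'.glue S'')) := by
  let f : S'.Comp ⊕ S''.Comp → (S'.glue S'').Comp := Glued.mk _ _
  let q : S.Comp ⊕ (S'.glue S'').Comp → (S.glue (S'.glue S'')).Comp := Glued.mk _ _
  let p : S.Comp ⊕ S'.Comp → (S.glue S').Comp := Glued.mk _ _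
  let r : (S.glue S').Comp ⊕ S''.Comp → ((S.glue S').glue S'').Comp := Glued.mk _ _
  have A := ((isGlue_glue S S').sum_right S''.genus).trans (isGlue_glue (S.glue S') S'')
    (s' := fun k => .inl (.inr (S'.tgt k))) (t' := fun k => .inr (S''.src k))
  have B0 := ((isGlue_glue S' S'').sum_right S.genus).congr
    (V' := S.Comp ⊕ (S'.Comp ⊕ S''.Comp)) (g' := Sum.elim S.genus (Sum.elim S'.genus S''.genus))
    (Equiv.sumComm _ _) (Equiv.refl K) (s' := fun k => .inr (.inl (S'.tgt k)))
    (t' := fun k => .inr (.inr (S''.src k)))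
    (fun _ => rfl) (fun _ => rfl) (by rintro (v | v) <;> rfl)
  have B1 := (isGlue_glue S (S'.glue S'')).congr (V' := (S'.glue S'').Comp ⊕ S.Comp)
    (g' := Sum.elim (S'.glue S'').genus S.genus) (Equiv.sumComm _ _) (Equiv.refl J)
    (s' := fun j => .inr (S.tgt j)) (t' := fun j => .inl (f (.inl (S'.src j))))
    (fun _ => rfl) (fun _ => rfl) (by rintro (v | v) <;> rfl)
  have B := (B0.trans (s' := fun j => .inl (S.tgt j)) (t' := fun j => .inr (.inl (S'.src j))) B1)
  have B' := B.congr (Equiv.sumAssoc S.Comp S'.Comp S''.Comp) (Equiv.sumComm J K)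
    (s' := Sum.elim (fun j => .inl (.inl (S.tgt j))) fun k => .inl (.inr (S'.tgt k)))
    (t' := Sum.elim (fun j => .inl (.inr (S'.src j))) fun k => .inr (S''.src k))
    (by rintro (e | e) <;> rfl) (by rintro (e | e) <;> rfl)
    (g' := Sum.elim (Sum.elim S.genus S'.genus) S''.genus)
    (by rintro ((v | v) | v) <;> rfl)
  obtain ⟨φ, h, h'⟩ := A.unique B'
  exact ⟨φ, fun i => h (.inl (.inl (S.src i))), fun l => h (.inr (S''.tgt l)), h'⟩

end Surface

/-- A closed one-dimensional manifold: a disjoint union of finitely many circles. -/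
structure Cob where
  circles : Type
  [fintype : Fintype circles]

attribute [instance] Cob.fintype

/-- The category of cobordisms: a morphism is a surface up to homeomorphism relative to its
boundary, composition is gluing. -/
noncomputable instance : Category Cob where
  Hom X Y := Quotient (Surface.setoid X.circles Y.circles)
  id X := ⟦Surface.cyl X.circles⟧
  comp := Quotient.map₂ Surface.glue fun _ _ h _ _ h' => Surface.glue_congr h h'
  id_comp := by rintro X Y ⟨S⟩; exact Quotient.sound (Surface.cyl_glue S)
  comp_id := by rintro X Y ⟨S⟩; exact Quotient.sound (Surface.glue_cyl S)
  assoc := by rintro W X Y Z ⟨S⟩ ⟨S'⟩ ⟨S''⟩; exact Quotient.sound (Surface.glue_assoc S S' S'')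

/-- The morphism given by a surface. -/
def Surface.hom {X Y : Cob} (S : Surface X.circles Y.circles) : X ⟶ Y :=
  Quotient.mk (Surface.setoid X.circles Y.circles) S

/-! ## The local relations -/

/-- Formal `R`-linear combinations of cobordisms. -/
abbrev FreeHom (R : Type u) [CommRing R] (X Y : Cob) : Type (max 1 u) := (X ⟶ Y) →₀ R

/-- The bilinear extension of the composition of cobordisms. -/
def freeComp (R : Type u) [CommRing R] (X Y Z : Cob) :
    FreeHom R X Y →ₗ[R] FreeHom R Y Z →ₗ[R] FreeHom R X Z :=
  Finsupp.linearCombination R fun m => Finsupp.lmapDomain R R fun m' => m ≫ m'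

/-- A surface as a formal sum. -/
def Surface.free (R : Type u) [CommRing R] {X Y : Cob} (S : Surface X.circles Y.circles) :
    FreeHom R X Y := Finsupp.single S.hom 1

/-- The local relations S, T and 4Tu. -/
inductive LocalRel (R : Type u) [CommRing R] (X Y : Cob) : FreeHom R X Y → Prop
  /-- A sphere is `0`. -/
  | sphere (S : Surface X.circles Y.circles) : LocalRel R X Y ((S.addClosed 0).free R)
  /-- A torus is `2`. -/
  | torus (S : Surface X.circles Y.circles) :
      LocalRel R X Y ((S.addClosed 1).free R - (2 : R) • S.free R)
  /-- Given four sites on a surface, adding a tube between the first two or between the last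
  two has the same sum as between the first and the third or the second and the fourth. -/
  | fourTu (S : Surface X.circles Y.circles) (a b c d : S.Comp) :
      LocalRel R X Y ((S.tube a b).free R + (S.tube c d).free R
        - ((S.tube a c).free R + (S.tube b d).free R))

/-- The two-sided ideal generated by the local relations. -/
def localIdeal (R : Type u) [CommRing R] (X Y : Cob) : Submodule R (FreeHom R X Y) :=
  Submodule.span R {f | ∃ (X' Y' : Cob) (a : FreeHom R X X') (r : FreeHom R X' Y')
    (b : FreeHom R Y' Y), LocalRel R X' Y' r ∧
      f = freeComp R X Y' Y (freeComp R X X' Y' a r) b}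

section Linear

variable {R : Type u} [CommRing R]

theorem freeComp_single {X Y Z : Cob} (m : X ⟶ Y) (m' : Y ⟶ Z) (r r' : R) :
    freeComp R X Y Z (Finsupp.single m r) (Finsupp.single m' r') =
      Finsupp.single (m ≫ m') (r * r') := by
  simp [freeComp]

theorem freeComp_id_left {X Y : Cob} (f : FreeHom R X Y) :
    freeComp R X X Y (Finsupp.single (𝟙 X) 1) f = f := by
  induction f using Finsupp.induction_linear with
  | zero => simp
  | add f g hf hg => rw [map_add, hf, hg]
  | single m r => rw [freeComp_single, Category.id_comp, one_mul]

theorem freeComp_id_right {X Y : Cob} (f : FreeHom R X Y) :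
    freeComp R X Y Y f (Finsupp.single (𝟙 Y) 1) = f := by
  induction f using Finsupp.induction_linear with
  | zero => simp
  | add f g hf hg => rw [map_add, LinearMap.add_apply, hf, hg]
  | single m r => rw [freeComp_single, Category.comp_id, mul_one]

theorem freeComp_assoc {W X Y Z : Cob} (f : FreeHom R W X) (g : FreeHom R X Y)
    (h : FreeHom R Y Z) : freeComp R W Y Z (freeComp R W X Y f g) h =
      freeComp R W X Z f (freeComp R X Y Z g h) := by
  induction f using Finsupp.induction_linear with
  | zero => simp
  | add f f' hf hf' => simp only [map_add, LinearMap.add_apply, hf, hf']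
  | single m r =>
    induction g using Finsupp.induction_linear with
    | zero => simp
    | add f f' hf hf' => simp only [map_add, LinearMap.add_apply, hf, hf']
    | single m' r' =>
      induction h using Finsupp.induction_linear with
      | zero => simp
      | add f f' hf hf' => simp only [map_add, hf, hf']
      | single m'' r'' => simp only [freeComp_single, Category.assoc, mul_assoc]

theorem freeComp_mem_right {X Y Z : Cob} (a : FreeHom R X Y) {f : FreeHom R Y Z}
    (hf : f ∈ localIdeal R Y Z) : freeComp R X Y Z a f ∈ localIdeal R X Z := by
  refine Submodule.span_induction (p := fun f _ => freeComp R X Y Z a f ∈ localIdeal R X Z)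
    ?_ ?_ ?_ ?_ hf
  · rintro _ ⟨X', Y', p, r, q, hr, rfl⟩
    exact Submodule.subset_span ⟨X', Y', _, r, q, hr, by rw [← freeComp_assoc, ← freeComp_assoc]⟩
  · rw [map_zero]; exact zero_mem _
  · intro x y _ _ hx hy; rw [map_add]; exact add_mem hx hy
  · intro c x _ hx; rw [map_smul]; exact Submodule.smul_mem _ _ hx

theorem freeComp_mem_left {X Y Z : Cob} (b : FreeHom R Y Z) {f : FreeHom R X Y}
    (hf : f ∈ localIdeal R X Y) : freeComp R X Y Z f b ∈ localIdeal R X Z := by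
  refine Submodule.span_induction (p := fun f _ => freeComp R X Y Z f b ∈ localIdeal R X Z)
    ?_ ?_ ?_ ?_ hf
  · rintro _ ⟨X', Y', p, r, q, hr, rfl⟩
    exact Submodule.subset_span ⟨X', Y', p, r, _, hr, by rw [freeComp_assoc]⟩
  · rw [map_zero]; exact zero_mem _
  · intro x y _ _ hx hy; rw [map_add]; exact add_mem hx hy
  · intro c x _ hx; rw [map_smul]; exact Submodule.smul_mem _ _ hx

end Linear

/-- The category of cobordisms over `R` modulo the local relations (written `Cob_{/l}`):
the objects are those of `Cob`, the morphisms are formal `R`-linear combinations of cobordisms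
modulo the local relations. -/
@[ext]
structure CobL (R : Type u) [CommRing R] where
  cob : Cob

/-- Composition modulo the local relations. -/
def CobL.comp {R : Type u} [CommRing R] (X Y Z : Cob) :
    (FreeHom R X Y ⧸ localIdeal R X Y) →ₗ[R] (FreeHom R Y Z ⧸ localIdeal R Y Z) →ₗ[R]
      (FreeHom R X Z ⧸ localIdeal R X Z) :=
  Submodule.liftQ _ (LinearMap.flip (Submodule.liftQ _
    (((freeComp R X Y Z).compr₂ (Submodule.mkQ _)).flip) fun g hg =>
      LinearMap.ext fun f => (Submodule.Quotient.mk_eq_zero _).2 (freeComp_mem_right f hg))) fun f hf => by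
    refine LinearMap.ext fun g => ?_
    obtain ⟨g, rfl⟩ := Submodule.Quotient.mk_surjective _ g
    exact (Submodule.Quotient.mk_eq_zero _).2 (freeComp_mem_left g hf)

theorem CobL.comp_mk {R : Type u} [CommRing R] {X Y Z : Cob} (f : FreeHom R X Y)
    (g : FreeHom R Y Z) : CobL.comp X Y Z (Submodule.Quotient.mk f) (Submodule.Quotient.mk g) =
      Submodule.Quotient.mk (freeComp R X Y Z f g) := rfl

instance (R : Type u) [CommRing R] : Category (CobL R) where
  Hom X Y := FreeHom R X.cob Y.cob ⧸ localIdeal R X.cob Y.cob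
  id X := Submodule.Quotient.mk (Finsupp.single (𝟙 X.cob) 1)
  comp f g := CobL.comp _ _ _ f g
  id_comp f := by
    obtain ⟨f, rfl⟩ := Submodule.Quotient.mk_surjective _ f
    rw [CobL.comp_mk, freeComp_id_left]
  comp_id f := by
    obtain ⟨f, rfl⟩ := Submodule.Quotient.mk_surjective _ f
    rw [CobL.comp_mk, freeComp_id_right]
  assoc f g h := by
    obtain ⟨f, rfl⟩ := Submodule.Quotient.mk_surjective _ f
    obtain ⟨g, rfl⟩ := Submodule.Quotient.mk_surjective _ g
    obtain ⟨h, rfl⟩ := Submodule.Quotient.mk_surjective _ h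
    simp only [CobL.comp_mk, freeComp_assoc]

instance (R : Type u) [CommRing R] : Preadditive (CobL R) where
  homGroup X Y := inferInstanceAs (AddCommGroup (FreeHom R X.cob Y.cob ⧸ localIdeal R X.cob Y.cob))
  add_comp X Y Z f g h :=
    LinearMap.congr_fun (map_add (CobL.comp (R := R) X.cob Y.cob Z.cob)
      (show FreeHom R X.cob Y.cob ⧸ localIdeal R X.cob Y.cob from f) g) h
  comp_add X Y Z f g h :=
    map_add (CobL.comp (R := R) X.cob Y.cob Z.cob f)
      (show FreeHom R Y.cob Z.cob ⧸ localIdeal R Y.cob Z.cob from g) h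

/-- The morphism of `CobL R` given by a surface. -/
def Surface.homL (R : Type u) [CommRing R] {X Y : Cob} (S : Surface X.circles Y.circles) :
    (⟨X⟩ : CobL R) ⟶ ⟨Y⟩ :=
  Submodule.Quotient.mk (S.free R)


/-! ## The TQFT of a Frobenius system of rank two -/

/-- A Frobenius system of rank two: a commutative `k`-algebra `A` with a counit, two elements `v`
which span `A`, and two dual elements `dual` which give the coordinates by means of the pairing
`(a, b) ↦ counit (a * b)`. The comultiplication is `a ↦ ∑ x, a * dual x ⊗ v x`. -/
structure Frobenius (k : Type u) (A : Type v) [CommRing k] [CommRing A] [Algebra k A] where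
  counit : A →ₗ[k] k
  v : Bool → A
  dual : Bool → A
  sum_counit_smul : ∀ a, ∑ x, counit (a * dual x) • v x = a

open Classical in
/-- The product of the `a i` over the fibre of `f` over `k`. -/
def fibProd {I K M : Type*} [Fintype I] [CommMonoid M] (f : I → K) (a : I → M) (k : K) : M :=
  ∏ i with f i = k, a i

theorem fibProd_mul {I K M : Type*} [Fintype I] [CommMonoid M] (f : I → K) (a b : I → M) (k : K) :
    fibProd f (fun i => a i * b i) k = fibProd f a k * fibProd f b k := by
  classical
  exact Finset.prod_mul_distrib

theorem fibProd_comp {V K L M : Type*} [Fintype V] [Fintype K] [CommMonoid M] (f : V → K)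
    (h : K → L) (a : V → M) (l : L) :
    fibProd h (fibProd f a) l = fibProd (fun v => h (f v)) a l := by
  classical
  unfold fibProd
  rw [← Finset.prod_fiberwise_of_maps_to (s := Finset.univ.filter fun v => h (f v) = l)
    (t := Finset.univ.filter fun k => h k = l) (g := f) (by simp) a]
  refine Finset.prod_congr (by ext; simp) fun k hk => Finset.prod_congr ?_ fun _ _ => rfl
  ext v
  simp only [Finset.mem_filter, Finset.mem_univ, true_and] at hk ⊢
  constructor
  · rintro rfl; exact ⟨hk, rfl⟩
  · exact fun h => h.2

theorem fibProd_sum {V W K M : Type*} [Fintype V] [Fintype W] [CommMonoid M] (f : V ⊕ W → K)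
    (a : V ⊕ W → M) (k : K) :
    fibProd f a k = fibProd (fun v => f (.inl v)) (fun v => a (.inl v)) k
      * fibProd (fun v => f (.inr v)) (fun v => a (.inr v)) k := by
  classical
  simp only [fibProd, Finset.prod_filter, Fintype.prod_sum_type]

theorem fibProd_inj {V K M : Type*} [Fintype V] [CommMonoid M] (f : V → K)
    (hf : Function.Injective f) (a : V → M) (v : V) : fibProd f a (f v) = a v := by
  classical
  simp [fibProd, Finset.prod_filter, hf.eq_iff]

theorem sum_equiv' {X Y M : Type*} {_ : Fintype X} {_ : Fintype Y} [AddCommMonoid M] (e : X ≃ Y)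
    {f : X → M} {g : Y → M} (h : ∀ x, f x = g (e x)) : ∑ x, f x = ∑ y, g y :=
  Fintype.sum_equiv e f g h

namespace Frobenius

variable {k : Type u} {A : Type v} [CommRing k] [CommRing A] [Algebra k A] (Φ : Frobenius k A)

/-- The handle element: multiplication by it is multiplication after comultiplication. -/
def handle : A := ∑ x, Φ.v x * Φ.dual x

theorem sum_counit_mul (a b : A) :
    ∑ x, Φ.counit (a * Φ.dual x) * Φ.counit (b * Φ.v x) = Φ.counit (a * b) := by
  conv_rhs => rw [mul_comm, ← Φ.sum_counit_smul a, Finset.mul_sum, map_sum]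
  refine Finset.sum_congr rfl fun x _ => ?_
  rw [mul_smul_comm, map_smul, smul_eq_mul]

open Classical in
/-- The value of a gluing of pieces decorated by elements of the algebra. -/
def glueSum {V E : Type} [Fintype V] [Fintype E] (s t : E → V) (g : V → ℕ) (x : V → A) : k :=
  ∑ l : E → Bool, ∏ v, Φ.counit (Φ.handle ^ g v * (x v * fibProd s (fun e => Φ.dual (l e)) v
    * fibProd t (fun e => Φ.v (l e)) v))

/-- The value of a union of closed pieces. -/
def compProd {K : Type} [Fintype K] (γ : K → ℕ) (x : K → A) : k :=
  ∏ k, Φ.counit (Φ.handle ^ γ k * x k)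

open Classical in
theorem glueSum_sum {V E E' : Type} [Fintype V] [Fintype E] [Fintype E'] (s t : E ⊕ E' → V)
    (g : V → ℕ) (x : V → A) :
    Φ.glueSum s t g x = ∑ l' : E' → Bool, Φ.glueSum (fun e => s (.inl e)) (fun e => t (.inl e)) g
      fun v => x v * fibProd (fun e => s (.inr e)) (fun e => Φ.dual (l' e)) v
        * fibProd (fun e => t (.inr e)) (fun e => Φ.v (l' e)) v := by
  unfold glueSum
  rw [Finset.sum_comm, ← Fintype.sum_prod_type']
  apply sum_equiv' (Equiv.sumArrowEquivProdArrow E E' Bool)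
  intro l
  refine Finset.prod_congr rfl fun v _ => ?_
  simp only [fibProd_sum]
  congr 2
  change _ = _ * fibProd _ (fun e => Φ.dual (l (.inr e))) v *
    fibProd _ (fun e => Φ.v (l (.inr e))) v * fibProd _ (fun e => Φ.dual (l (.inl e))) v *
    fibProd _ (fun e => Φ.v (l (.inl e))) v
  ring

theorem glueSum_equiv {V E E' : Type} [Fintype V] [Fintype E] [Fintype E']
    (ψ : E' ≃ E) (s t : E → V) (g : V → ℕ) (x : V → A) :
    Φ.glueSum (fun e => s (ψ e)) (fun e => t (ψ e)) g x = Φ.glueSum s t g x := by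
  classical
  unfold glueSum
  refine Fintype.sum_equiv (Equiv.arrowCongr ψ (Equiv.refl Bool)) _ _ fun l =>
    Finset.prod_congr rfl fun v _ => ?_
  have : ∀ (p : E → V) (a : E → A),
      fibProd (fun e => p (ψ e)) (fun e => a (ψ e)) v = fibProd p a v := by
    intro p a
    simp only [fibProd, Finset.prod_filter]
    exact Equiv.prod_comp ψ fun e => if p e = v then a e else 1
  rw [← this s, ← this t]
  simp

theorem compProd_bij {V K : Type} [Fintype V] [Fintype K] (f : V → K) (hf : f.Bijective)
    (γ : K → ℕ) (x : V → A) :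
    Φ.compProd γ (fibProd f x) = ∏ v, Φ.counit (Φ.handle ^ γ (f v) * x v) := by
  unfold compProd
  rw [← hf.prod_comp]
  simp only [fibProd_inj f hf.1]

theorem glueSum_empty {V K : Type} [Fintype V] [Fintype K] {s t : Empty → V} {g : V → ℕ}
    {f : V → K} {γ : K → ℕ} (H : IsGlue s t g f γ) (x : V → A) :
    Φ.glueSum s t g x = Φ.compProd γ (fibProd f x) := by
  classical
  have hf : f.Bijective :=
    ⟨fun v w h => (H.lift (fun y => v = y) (fun e => e.elim) v w h rfl), H.surj⟩
  rw [Φ.compProd_bij f hf]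
  simp only [glueSum, fibProd, Finset.univ_eq_empty, Finset.filter_empty, Finset.prod_empty,
    mul_one, Fintype.sum_unique]
  refine Finset.prod_congr rfl fun v _ => ?_
  have a := H.genus (f v)
  rw [fibSum_inj f hf.1, fibSum_inj f hf.1] at a
  simp only [fibSum, Finset.univ_eq_empty, Finset.filter_empty, Finset.sum_empty,
    Pi.one_apply] at a
  rw [show γ (f v) = g v by omega]

theorem glueSum_unit_eq {V : Type} [Fintype V] (a b : V) (g : V → ℕ) (x : V → A) [DecidableEq V] :
    Φ.glueSum (fun _ : Unit => a) (fun _ => b) g x = ∑ l, ∏ v, Φ.counit (Φ.handle ^ g v *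
      (x v * (if a = v then Φ.dual l else 1) * (if b = v then Φ.v l else 1))) := by
  classical
  unfold glueSum
  apply sum_equiv' (Equiv.funUnique Unit Bool)
  intro l
  refine Finset.prod_congr rfl fun v _ => ?_
  change _ = Φ.counit (Φ.handle ^ g v *
      (x v * (if a = v then Φ.dual (l ()) else 1) * (if b = v then Φ.v (l ()) else 1)))
  congr 3
  · congr 1
    by_cases h : a = v <;> simp [fibProd, h]
  · by_cases h : b = v <;> simp [fibProd, h]

theorem glueSum_unit {V K : Type} [Fintype V] [Fintype K] {s t : Unit → V} {g : V → ℕ}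
    {f : V → K} {γ : K → ℕ} (H : IsGlue s t g f γ) (x : V → A) :
    Φ.glueSum s t g x = Φ.compProd γ (fibProd f x) := by
  classical
  obtain ⟨a, rfl⟩ : ∃ a, s = fun _ => a := ⟨s (), rfl⟩
  obtain ⟨b, rfl⟩ : ∃ b, t = fun _ => b := ⟨t (), rfl⟩
  have hf : ∀ v w, f v = f w → v = w ∨ (v = a ∧ w = b) ∨ (v = b ∧ w = a) := by
    intro v w hvw
    by_contra! hc
    by_cases hv : v = a ∨ v = b
    · have := H.lift (fun y => y = a ∨ y = b) (by simp) v w hvw hv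
      grind
    · have := H.lift (fun y => y = v) (by grind) v w hvw rfl
      grind
  have hab : f a = f b := H.eq ()
  rw [glueSum_unit_eq]
  by_cases h : a = b
  · subst h
    have hf' : f.Bijective := ⟨fun v w h => by rcases hf v w h with h | h | h <;> grind, H.surj⟩
    rw [Φ.compProd_bij f hf']
    have hγ : ∀ v, γ (f v) = g v + if a = v then 1 else 0 := by
      intro v
      have e := H.genus (f v)
      rw [fibSum_inj f hf'.1, fibSum_inj f hf'.1] at e
      have : fibSum (fun _ : Unit => f a) 1 (f v) = if a = v then 1 else 0 := by
        by_cases h : a = v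
        · simp [fibSum, h]
        · simp [fibSum, h, hf'.1.eq_iff]
      rw [this, Pi.one_apply] at e
      omega
    have e1 : ∀ l, ∏ v, Φ.counit (Φ.handle ^ g v *
        (x v * (if a = v then Φ.dual l else 1) * (if a = v then Φ.v l else 1))) =
        Φ.counit (Φ.handle ^ g a * (x a * Φ.dual l * Φ.v l)) *
        ∏ v ∈ Finset.univ.erase a, Φ.counit (Φ.handle ^ γ (f v) * x v) := by
      intro l
      rw [← Finset.mul_prod_erase _ _ (Finset.mem_univ a)]
      congr 1
      · simp
      · refine Finset.prod_congr rfl fun v hv => ?_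
        have : a ≠ v := (Finset.ne_of_mem_erase hv).symm
        simp [hγ, this]
    simp only [e1]
    rw [← Finset.sum_mul, ← Finset.mul_prod_erase _ _ (Finset.mem_univ a), ← map_sum]
    congr 2
    rw [hγ, if_pos rfl, pow_succ, mul_assoc, ← Finset.mul_sum, handle, Finset.sum_mul]
    congr 1
    exact Finset.sum_congr rfl fun l _ => by ring
  · have hset : (Finset.univ.filter fun v => f v = f a) = {a, b} := by
      ext v
      simp only [Finset.mem_filter, Finset.mem_univ, true_and, Finset.mem_insert,
        Finset.mem_singleton]
      constructor
      · intro hv; rcases hf v a hv with h | h | h <;> grind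
      · rintro (rfl | rfl) <;> simp [hab]
    have hγ1 : γ (f a) = g a + g b := by
      have e := H.genus (f a)
      have e1 : ∀ w : V → ℕ, fibSum f w (f a) = w a + w b := by
        intro w
        rw [← Finset.sum_pair h, ← hset]
        simp [fibSum]
      have e3 : fibSum (fun _ : Unit => f a) 1 (f a) = 1 := by simp [fibSum]
      rw [e1, e1, e3, Pi.one_apply, Pi.one_apply] at e
      omega
    have hx1 : fibProd f x (f a) = x a * x b := by
      rw [← Finset.prod_pair h, ← hset]
      simp [fibProd]
    have hS : ∀ v ∈ (Finset.univ.erase a).erase b, v ≠ a ∧ v ≠ b ∧ ∀ w, f w = f v ↔ w = v := by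
      intro v hv
      simp only [Finset.mem_erase, Finset.mem_univ, and_true] at hv
      refine ⟨hv.2, hv.1, fun w => ⟨fun hw => ?_, fun h => by rw [h]⟩⟩
      rcases hf w v hw with h | h | h <;> grind
    have hγ2 : ∀ v ∈ (Finset.univ.erase a).erase b, γ (f v) = g v := by
      intro v hv
      have e := H.genus (f v)
      have e1 : ∀ w : V → ℕ, fibSum f w (f v) = w v := by
        intro w; simp [fibSum, (hS v hv).2.2, Finset.sum_filter]
      have e3 : fibSum (fun _ : Unit => f a) 1 (f v) = 0 := by
        simp [fibSum, (hS v hv).2.2, (hS v hv).1.symm]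
      rw [e1, e1, e3, Pi.one_apply] at e
      omega
    have hx2 : ∀ v ∈ (Finset.univ.erase a).erase b, fibProd f x (f v) = x v := by
      intro v hv
      simp [fibProd, (hS v hv).2.2, Finset.prod_filter]
    have hb : b ∈ Finset.univ.erase a := by simp [Ne.symm h]
    have himg : Finset.univ.erase (f a) = ((Finset.univ.erase a).erase b).image f := by
      ext k
      simp only [Finset.mem_erase, Finset.mem_univ, and_true, Finset.mem_image]
      constructor
      · intro hk
        obtain ⟨v, rfl⟩ := H.surj k
        exact ⟨v, ⟨by rintro rfl; exact hk hab.symm, by rintro rfl; exact hk rfl⟩, rfl⟩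
      · rintro ⟨v, hv, rfl⟩ hk
        exact hv.2 (((hS v (by simp [hv])).2.2 a).1 hk.symm).symm
    unfold compProd
    rw [← Finset.mul_prod_erase _ _ (Finset.mem_univ (f a)), himg,
      Finset.prod_image fun v hv w _ hvw => (((hS v hv).2.2 w).1 hvw.symm).symm]
    have e1 : ∀ l, ∏ v, Φ.counit (Φ.handle ^ g v *
        (x v * (if a = v then Φ.dual l else 1) * (if b = v then Φ.v l else 1))) =
        Φ.counit (Φ.handle ^ g a * x a * Φ.dual l) * Φ.counit (Φ.handle ^ g b * x b * Φ.v l) *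
        ∏ v ∈ (Finset.univ.erase a).erase b,
          Φ.counit (Φ.handle ^ γ (f v) * fibProd f x (f v)) := by
      intro l
      rw [← Finset.mul_prod_erase _ _ (Finset.mem_univ a), ← Finset.mul_prod_erase _ _ hb,
        ← mul_assoc]
      congr 1
      · congr 2
        · simp [Ne.symm h, mul_assoc]
        · simp [h, mul_assoc]
      · refine Finset.prod_congr rfl fun v hv => ?_
        rw [hγ2 v hv, hx2 v hv, if_neg (hS v hv).1.symm, if_neg (hS v hv).2.1.symm, mul_one, mul_one]
    simp only [e1]
    rw [← Finset.sum_mul, Φ.sum_counit_mul]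
    congr 2
    rw [hγ1, hx1]
    ring

/-- The value of a decorated surface does not depend on how it is cut. -/
theorem glueSum_eq {E : Type} [Fintype E] : ∀ {V K : Type} [Fintype V] [Fintype K] {s t : E → V}
    {g : V → ℕ} {f : V → K} {γ : K → ℕ} (_ : IsGlue s t g f γ) (x : V → A),
    Φ.glueSum s t g x = Φ.compProd γ (fibProd f x) := by
  classical
  have key : ∀ (n : ℕ) (E : Type) [Fintype E], Fintype.card E = n →
      ∀ {V K : Type} [Fintype V] [Fintype K] {s t : E → V}
      {g : V → ℕ} {f : V → K} {γ : K → ℕ} (_ : IsGlue s t g f γ) (x : V → A),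
      Φ.glueSum s t g x = Φ.compProd γ (fibProd f x) := by
    intro n
    induction n with
    | zero =>
      intro E _ hE V K _ _ s t g f γ H x
      have ψ : Empty ≃ E := (Fintype.equivOfCardEq (by simp [hE]))
      rw [← Φ.glueSum_equiv ψ]
      exact Φ.glueSum_empty (H.congr (Equiv.refl V) ψ (fun _ => rfl) (fun _ => rfl) fun _ => rfl) x
    | succ n ih =>
      intro E _ hE V K _ _ s t g f γ H x
      have ψ : Fin n ⊕ Unit ≃ E := (Fintype.equivOfCardEq (by simp [hE]))
      have H' := H.congr (Equiv.refl V) ψ (s' := fun e => s (ψ e)) (t' := fun e => t (ψ e))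
        (fun _ => rfl) (fun _ => rfl) fun _ => rfl
      rw [← Φ.glueSum_equiv ψ, glueSum_sum]
      have H1 := isGlue_glued (fun e => s (ψ (.inl e))) (fun e => t (ψ (.inl e))) g
      have H2 := isGlue_glued (fun e => Glued.mk _ _ (s (ψ (.inr e))))
        (fun e => Glued.mk (fun e => s (ψ (.inl e))) (fun e => t (ψ (.inl e))) (t (ψ (.inr e))))
        (gluedGenus (fun e => s (ψ (.inl e))) (fun e => t (ψ (.inl e))) g)
      have H3 := H1.trans H2
      have es : ∀ p : Fin n ⊕ Unit → V,
          (Sum.elim (fun e => p (.inl e)) fun e => p (.inr e)) = p := fun p => by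
        ext (e | e) <;> rfl
      rw [es fun e => s (ψ e), es fun e => t (ψ e)] at H3
      obtain ⟨φ, h1, h2⟩ := H3.unique H'
      have e1 := fun x => ih (Fin n) (by simp) H1 x
      rw [Finset.sum_congr rfl fun l _ => e1 _]
      have e2 := Φ.glueSum_unit H2 (fibProd (Glued.mk _ _) x)
      unfold glueSum at e2
      unfold compProd at e2 ⊢
      simp only [fibProd_mul, fibProd_comp] at e2 ⊢
      refine e2.trans (Fintype.prod_equiv φ _ _ fun k => ?_)
      rw [h2]
      congr 2
      simp only [fibProd]
      refine Finset.prod_congr ?_ fun _ _ => rfl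
      ext v
      have := h1 v
      simp only [Finset.mem_filter, Finset.mem_univ, true_and]
      change _ ↔ f v = _
      rw [show f v = φ _ from (h1 v).symm, φ.injective.eq_iff]
  intro V K _ _ s t g f γ H x
  exact key _ E rfl H x

/-- The value of a surface with boundary circles decorated by elements of the algebra: the product
over the components of `counit (handle ^ genus * ∏ decorations)`. -/
def amp {I J : Type} [Fintype I] [Fintype J] (S : Surface I J) (a : I → A) (b : J → A) : k :=
  Φ.compProd S.genus fun c => fibProd S.src a c * fibProd S.tgt b c

theorem amp_update {I J : Type} [Fintype I] [Fintype J] [DecidableEq I] (S : Surface I J)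
    (a : I → A) (b : J → A) (i : I) :
    ∃ (y : A) (r : k), ∀ x, Φ.amp S (Function.update a i x) b = Φ.counit (x * y) * r := by
  classical
  refine ⟨Φ.handle ^ S.genus (S.src i) * ((∏ j ∈ (Finset.univ.filter
    fun j => S.src j = S.src i).erase i, a j) * fibProd S.tgt b (S.src i)),
    ∏ c ∈ Finset.univ.erase (S.src i),
      Φ.counit (Φ.handle ^ S.genus c * (fibProd S.src a c * fibProd S.tgt b c)), fun x => ?_⟩
  unfold amp compProd
  rw [← Finset.mul_prod_erase _ _ (Finset.mem_univ (S.src i))]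
  congr 1
  · congr 1
    have : fibProd S.src (Function.update a i x) (S.src i) =
        x * ∏ j ∈ (Finset.univ.filter fun j => S.src j = S.src i).erase i, a j := by
      have hi : i ∈ Finset.univ.filter fun j => S.src j = S.src i := by simp
      have e : fibProd S.src (Function.update a i x) (S.src i) =
          ∏ j with S.src j = S.src i, Function.update a i x j := by simp [fibProd]
      rw [e, ← Finset.mul_prod_erase _ _ hi, Function.update_self]
      congr 1
      exact Finset.prod_congr rfl fun j hj =>
        Function.update_of_ne (Finset.ne_of_mem_erase hj) _ _
    beta_reduce
    rw [this]
    ring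
  · refine Finset.prod_congr rfl fun c hc => ?_
    beta_reduce
    congr 3
    refine Finset.prod_congr rfl fun j hj => Function.update_of_ne ?_ _ _
    rintro rfl
    simp only [Finset.mem_filter, Finset.mem_univ, true_and] at hj
    exact Finset.ne_of_mem_erase hc hj.symm

theorem amp_homeo {I J : Type} [Fintype I] [Fintype J] {S S' : Surface I J} (h : S.Homeo S')
    (a : I → A) (b : J → A) : Φ.amp S a b = Φ.amp S' a b := by
  obtain ⟨φ, h1, h2, h3⟩ := h
  refine Fintype.prod_equiv φ _ _ fun c => ?_
  have z : ∀ {X : Type} [Fintype X] (p : X → S.Comp) (q : X → A),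
      fibProd (fun x => φ (p x)) q (φ c) = fibProd p q c := by
    intro X _ p q
    refine Finset.prod_congr ?_ fun _ _ => rfl
    ext x
    simp
  beta_reduce
  rw [h3, ← z S.src, ← z S.tgt, funext h1, funext h2]

open Classical in
theorem amp_glue {I J K : Type} [Fintype I] [Fintype J] [Fintype K] (S : Surface I J)
    (S' : Surface J K) (a : I → A) (b : K → A) :
    ∑ l : J → Bool, Φ.amp S a (fun j => Φ.dual (l j)) * Φ.amp S' (fun j => Φ.v (l j)) b =
      Φ.amp (S.glue S') a b := by
  have e := Φ.glueSum_eq (S.isGlue_glue S')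
    (Sum.elim (fibProd S.src a) (fibProd S'.tgt b))
  have z1 : ∀ {X Y Z : Type} [Fintype X] (p : X → Y) (q : X → A) (y : Z),
      fibProd (fun j => (Sum.inl (p j) : Y ⊕ Z)) q (.inr y) = 1 := by
    intros; simp [fibProd]
  have z2 : ∀ {X Y Z : Type} [Fintype X] (p : X → Z) (q : X → A) (y : Y),
      fibProd (fun j => (Sum.inr (p j) : Y ⊕ Z)) q (.inl y) = 1 := by
    intros; simp [fibProd]
  have z3 : ∀ {X Y Z : Type} [Fintype X] (p : X → Y) (q : X → A) (y : Y),
      fibProd (fun j => (Sum.inl (p j) : Y ⊕ Z)) q (.inl y) = fibProd p q y := by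
    intros; simp [fibProd]
  have z4 : ∀ {X Y Z : Type} [Fintype X] (p : X → Z) (q : X → A) (y : Z),
      fibProd (fun j => (Sum.inr (p j) : Y ⊕ Z)) q (.inr y) = fibProd p q y := by
    intros; simp [fibProd]
  unfold glueSum at e
  simp only [Fintype.prod_sum_type, Sum.elim_inl, Sum.elim_inr, z1, z2, z3, z4, mul_one] at e
  unfold amp
  refine Eq.trans (Finset.sum_congr rfl fun l _ => ?_) (e.trans ?_)
  · unfold compProd
    congr 1
    refine Finset.prod_congr rfl fun c _ => ?_
    congr 2
    exact mul_comm _ _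
  · unfold compProd
    refine Finset.prod_congr rfl fun c _ => ?_
    congr 2
    rw [fibProd_sum]
    simp only [Sum.elim_inl, Sum.elim_inr]
    congr 1
    · exact fibProd_comp (fun i => S.src i) (fun c => Glued.mk _ _ (.inl c)) a c
    · exact fibProd_comp (fun i => S'.tgt i) (fun c => Glued.mk _ _ (.inr c)) b c

open Classical in
/-- The linear map of a surface, in terms of the basis of the target: on a connected surface of
genus `g` it is iterated multiplication, followed by `g` times multiplication after
comultiplication, followed by iterated comultiplication. -/
def surfaceMap {I J : Type} [Fintype I] [Fintype J] (S : Surface I J) :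
    (⨂[k] _ : I, A) →ₗ[k] ⨂[k] _ : J, A :=
  PiTensorProduct.lift
    { toFun := fun a => ∑ l : J → Bool,
        Φ.amp S a (fun j => Φ.dual (l j)) • PiTensorProduct.tprod k fun j => Φ.v (l j)
      map_update_add' := by
        intro _ a i x y
        rw [← Finset.sum_add_distrib]
        refine Finset.sum_congr rfl fun l _ => ?_
        obtain ⟨z, r, h⟩ := Φ.amp_update S a (fun j => Φ.dual (l j)) i
        rw [h, h, h, add_mul, map_add, add_mul, add_smul]
      map_update_smul' := by
        intro _ a i c x
        rw [Finset.smul_sum]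
        refine Finset.sum_congr rfl fun l _ => ?_
        obtain ⟨z, r, h⟩ := Φ.amp_update S a (fun j => Φ.dual (l j)) i
        rw [h, h, smul_mul_assoc, map_smul, smul_eq_mul, mul_assoc, mul_smul] }

open Classical in
theorem surfaceMap_tprod {I J : Type} [Fintype I] [Fintype J] (S : Surface I J) (a : I → A) :
    Φ.surfaceMap S (PiTensorProduct.tprod k a) = ∑ l : J → Bool,
      Φ.amp S a (fun j => Φ.dual (l j)) • PiTensorProduct.tprod k fun j => Φ.v (l j) :=
  PiTensorProduct.lift.tprod _

theorem surfaceMap_homeo {I J : Type} [Fintype I] [Fintype J] {S S' : Surface I J}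
    (h : S.Homeo S') : Φ.surfaceMap S = Φ.surfaceMap S' := by
  refine PiTensorProduct.ext (MultilinearMap.ext fun a => ?_)
  simp only [LinearMap.compMultilinearMap_apply, surfaceMap_tprod, Φ.amp_homeo h]

theorem surfaceMap_glue {I J K : Type} [Fintype I] [Fintype J] [Fintype K] (S : Surface I J)
    (S' : Surface J K) : Φ.surfaceMap (S.glue S') = Φ.surfaceMap S' ∘ₗ Φ.surfaceMap S := by
  classical
  refine PiTensorProduct.ext (MultilinearMap.ext fun a => ?_)
  simp only [LinearMap.compMultilinearMap_apply, LinearMap.comp_apply, surfaceMap_tprod, map_sum,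
    map_smul, Finset.smul_sum, ← amp_glue, Finset.sum_smul, mul_smul]
  rw [Finset.sum_comm]

theorem surfaceMap_cyl (I : Type) [Fintype I] :
    Φ.surfaceMap (Surface.cyl I) = LinearMap.id := by
  classical
  refine PiTensorProduct.ext (MultilinearMap.ext fun a => ?_)
  simp only [LinearMap.compMultilinearMap_apply, surfaceMap_tprod, LinearMap.id_apply]
  conv_rhs => rw [show a = fun i => ∑ x, Φ.counit (a i * Φ.dual x) • Φ.v x from
    funext fun i => (Φ.sum_counit_smul _).symm]
  rw [MultilinearMap.map_sum]
  refine Finset.sum_congr rfl fun l _ => ?_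
  rw [MultilinearMap.map_smul_univ]
  congr 1
  refine Finset.prod_congr rfl fun i _ => ?_
  have e : ∀ q : I → A, fibProd id q i = q i := fun q => fibProd_inj id Function.injective_id q i
  change Φ.counit (Φ.handle ^ 0 * (fibProd id _ i * fibProd id _ i)) = _
  rw [pow_zero, one_mul]
  exact congrArg Φ.counit (congrArg₂ _ (e _) (e _))

theorem amp_addClosed {I J : Type} [Fintype I] [Fintype J] (S : Surface I J) (g : ℕ) (a : I → A)
    (b : J → A) : Φ.amp (S.addClosed g) a b = Φ.counit (Φ.handle ^ g) * Φ.amp S a b := by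
  classical
  have z1 : ∀ {X : Type} [Fintype X] (p : X → S.Comp) (q : X → A),
      fibProd (fun j => some (p j)) q none = 1 := by
    intros; simp [fibProd]
  have z2 : ∀ {X : Type} [Fintype X] (p : X → S.Comp) (q : X → A) (c : S.Comp),
      fibProd (fun j => some (p j)) q (some c) = fibProd p q c := by
    intros; simp [fibProd]
  unfold amp compProd
  refine (Fintype.prod_option _).trans ?_
  congr 1
  · change Φ.counit (Φ.handle ^ g * (fibProd (fun i => some (S.src i)) a none *
      fibProd (fun i => some (S.tgt i)) b none)) = _
    rw [z1, z1, mul_one, mul_one]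
  · refine Finset.prod_congr rfl fun c _ => ?_
    change Φ.counit (Φ.handle ^ S.genus c * (fibProd (fun i => some (S.src i)) a (some c) *
      fibProd (fun i => some (S.tgt i)) b (some c))) = _
    rw [z2, z2]

open Classical in
theorem amp_tube {I J : Type} [Fintype I] [Fintype J] (S : Surface I J) (p q : S.Comp) (a : I → A)
    (b : J → A) : Φ.amp (S.tube p q) a b = ∑ x, Φ.compProd S.genus fun c =>
      fibProd S.src a c * fibProd S.tgt b c * (if p = c then Φ.dual x else 1)
        * (if q = c then Φ.v x else 1) := by
  have e := Φ.glueSum_eq (isGlue_glued (fun _ : Unit => p) (fun _ => q) S.genus)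
    fun c => fibProd S.src a c * fibProd S.tgt b c
  rw [glueSum_unit_eq] at e
  refine Eq.trans ?_ (e.symm.trans rfl)
  unfold amp compProd
  refine Finset.prod_congr rfl fun c _ => ?_
  congr 2
  refine Eq.symm ((fibProd_mul _ _ _ _).trans ?_)
  exact congrArg₂ _ (fibProd_comp S.src _ a c) (fibProd_comp S.tgt _ b c)

theorem surfaceMap_sphere (h : Φ.counit 1 = 0) {I J : Type} [Fintype I] [Fintype J]
    (S : Surface I J) : Φ.surfaceMap (S.addClosed 0) = 0 := by
  refine PiTensorProduct.ext (MultilinearMap.ext fun a => ?_)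
  simp only [LinearMap.compMultilinearMap_apply, surfaceMap_tprod, amp_addClosed, pow_zero, h,
    zero_mul, zero_smul, Finset.sum_const_zero, LinearMap.zero_apply]

theorem surfaceMap_torus (h : Φ.counit Φ.handle = 2) {I J : Type} [Fintype I] [Fintype J]
    (S : Surface I J) : Φ.surfaceMap (S.addClosed 1) = (2 : k) • Φ.surfaceMap S := by
  refine PiTensorProduct.ext (MultilinearMap.ext fun a => ?_)
  simp only [LinearMap.compMultilinearMap_apply, surfaceMap_tprod, amp_addClosed, pow_one, h,
    LinearMap.smul_apply, Finset.smul_sum, mul_smul]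

theorem surfaceMap_fourTu (hv : Φ.v true = 1) (hd : Φ.dual false = 1)
    (hX : Φ.v false = Φ.dual true) {I J : Type} [Fintype I] [Fintype J]
    (S : Surface I J) (p q r s : S.Comp) :
    Φ.surfaceMap (S.tube p q) + Φ.surfaceMap (S.tube r s) =
      Φ.surfaceMap (S.tube p r) + Φ.surfaceMap (S.tube q s) := by
  classical
  obtain ⟨W, hW⟩ : ∃ W : (I → A) → (J → A) → S.Comp → k, ∀ p q a b,
      Φ.amp (S.tube p q) a b = W a b p + W a b q := by
    refine ⟨fun a b p => Φ.compProd S.genus fun c =>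
      fibProd S.src a c * fibProd S.tgt b c * (if p = c then Φ.dual true else 1),
      fun p q a b => ?_⟩
    rw [amp_tube, Fintype.sum_bool]
    simp only [hv, hd, hX, ite_self, mul_one]
  refine PiTensorProduct.ext (MultilinearMap.ext fun a => ?_)
  simp only [LinearMap.compMultilinearMap_apply, surfaceMap_tprod, LinearMap.add_apply, hW,
    ← Finset.sum_add_distrib, ← add_smul]
  refine Finset.sum_congr rfl fun l _ => ?_
  congr 1
  ring

end Frobenius

/-- The algebra `R[T][X] / (X² - T)` over `R[T]` (here `T` is the variable of the polynomial ring
`R[T]`, and `X` is called `ω` in the library). -/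
abbrev AT (R : Type u) [CommRing R] : Type u := QuadraticAlgebra R[X] (X : R[X]) 0

/-- The Frobenius system of `A_T`: the counit is `1 ↦ 0`, `X ↦ 1`, and the basis `v₊ = 1` (for
`true`), `v₋ = X` (for `false`) has the dual basis `X`, `1`. -/
def frobeniusT (R : Type u) [CommRing R] : Frobenius R[X] (AT R) where
  counit :=
    { toFun := fun a => a.im
      map_add' := fun _ _ => rfl
      map_smul' := fun _ _ => rfl }
  v x := if x then 1 else QuadraticAlgebra.omega
  dual x := if x then QuadraticAlgebra.omega else 1
  sum_counit_smul a := by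
    refine QuadraticAlgebra.ext ?_ ?_ <;>
      simp [QuadraticAlgebra.re_one, QuadraticAlgebra.im_one]



section FT

/-- The tensor power of `A_T` indexed by `I`. -/
abbrev ATpow (R : Type u) [CommRing R] (I : Type) : Type u := ⨂[R[X]] _ : I, AT R

variable (R : Type u) [CommRing R]

/-- The linear map of a cobordism. -/
def cobMap {X Y : Cob} (m : X ⟶ Y) :
    ATpow R X.circles →ₗ[R[X]] ATpow R Y.circles :=
  Quotient.lift (frobeniusT R).surfaceMap (fun _ _ h => (frobeniusT R).surfaceMap_homeo h) m

/-- The linear map of a formal linear combination of cobordisms; it is semilinear over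
the inclusion of `R` in `R[T]`. -/
def freeMap (X Y : Cob) :
    FreeHom R X Y →ₛₗ[(Polynomial.C : R →+* R[X])] (ATpow R X.circles →ₗ[R[X]] ATpow R Y.circles) where
  toFun f := f.sum fun m r => Polynomial.C r • cobMap R m
  map_add' _ _ := Finsupp.sum_add_index' (fun _ => by rw [map_zero, zero_smul])
    fun _ _ _ => by rw [map_add, add_smul]
  map_smul' r f := by
    rw [Finsupp.sum_smul_index fun _ => by rw [map_zero, zero_smul], Finsupp.smul_sum]
    simp only [Polynomial.C_mul, mul_smul]

variable {R}

theorem cobMap_hom {X Y : Cob} (S : Surface X.circles Y.circles) :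
    cobMap R S.hom = (frobeniusT R).surfaceMap S := rfl

theorem cobMap_id (X : Cob) : cobMap R (𝟙 X) = LinearMap.id :=
  (frobeniusT R).surfaceMap_cyl X.circles

theorem cobMap_comp {X Y Z : Cob} (m : X ⟶ Y) (m' : Y ⟶ Z) :
    cobMap R (m ≫ m') = cobMap R m' ∘ₗ cobMap R m := by
  induction m using Quotient.inductionOn with
  | _ S =>
    induction m' using Quotient.inductionOn with
    | _ S' => exact (frobeniusT R).surfaceMap_glue S S'

theorem freeMap_single {X Y : Cob} (m : X ⟶ Y) (r : R) :
    freeMap R X Y (Finsupp.single m r) = Polynomial.C r • cobMap R m :=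
  Finsupp.sum_single_index (h := fun m r => Polynomial.C r • cobMap R m)
    (by rw [map_zero, zero_smul])

theorem freeMap_free {X Y : Cob} (S : Surface X.circles Y.circles) :
    freeMap R X Y (S.free R) = (frobeniusT R).surfaceMap S := by
  rw [Surface.free, freeMap_single, map_one, one_smul, cobMap_hom]

theorem freeMap_comp {X Y Z : Cob} (f : FreeHom R X Y) (g : FreeHom R Y Z) :
    freeMap R X Z (freeComp R X Y Z f g) = freeMap R Y Z g ∘ₗ freeMap R X Y f := by
  induction f using Finsupp.induction_linear with
  | zero => simp
  | add f f' hf hf' => simp only [map_add, LinearMap.add_apply, hf, hf', LinearMap.comp_add]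
  | single m r =>
    induction g using Finsupp.induction_linear with
    | zero => simp
    | add f f' hf hf' => simp only [map_add, hf, hf', LinearMap.add_comp]
    | single m' r' =>
      rw [freeComp_single, freeMap_single, freeMap_single, freeMap_single, cobMap_comp,
        LinearMap.comp_smul, LinearMap.smul_comp, smul_smul, Polynomial.C_mul]

theorem freeMap_localRel {X Y : Cob} {f : FreeHom R X Y} (h : LocalRel R X Y f) :
    freeMap R X Y f = 0 := by
  cases h with
  | sphere S => rw [freeMap_free]; exact (frobeniusT R).surfaceMap_sphere rfl S
  | torus S =>
    have h : (frobeniusT R).counit (frobeniusT R).handle = 2 := by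
      simp [Frobenius.handle, frobeniusT, one_add_one_eq_two]
    rw [map_sub, map_smulₛₗ, freeMap_free, freeMap_free, sub_eq_zero,
      (frobeniusT R).surfaceMap_torus h S, C_ofNat]
  | fourTu S p q r s =>
    rw [map_sub, map_add, map_add, sub_eq_zero]
    simp only [freeMap_free]
    exact (frobeniusT R).surfaceMap_fourTu rfl rfl rfl S p q r s

theorem freeMap_localIdeal {X Y : Cob} {f : FreeHom R X Y} (h : f ∈ localIdeal R X Y) :
    freeMap R X Y f = 0 := by
  refine Submodule.span_induction (p := fun f _ => freeMap R X Y f = 0) ?_ (map_zero _) ?_ ?_ h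
  · rintro _ ⟨X', Y', a, r, b, hr, rfl⟩
    rw [freeMap_comp, freeMap_comp, freeMap_localRel hr, LinearMap.zero_comp, LinearMap.comp_zero]
  · intro x y _ _ hx hy
    rw [map_add, hx, hy, add_zero]
  · intro c x _ hx
    rw [map_smulₛₗ, hx, smul_zero]

/-- The linear map of a morphism of `CobL R`. -/
def cobLMap {X Y : CobL R} (f : X ⟶ Y) : ATpow R X.cob.circles →ₗ[R[X]] ATpow R Y.cob.circles :=
  Submodule.liftQ (localIdeal R X.cob Y.cob) (freeMap R X.cob Y.cob)
    (fun _ h => LinearMap.mem_ker.2 (freeMap_localIdeal h)) f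

theorem cobLMap_id (X : CobL R) : cobLMap (𝟙 X) = LinearMap.id := by
  refine (freeMap_single (𝟙 X.cob) (1 : R)).trans ?_
  rw [map_one, one_smul, cobMap_id]

theorem cobLMap_comp {X Y Z : CobL R} (f : X ⟶ Y) (g : Y ⟶ Z) :
    cobLMap (f ≫ g) = cobLMap g ∘ₗ cobLMap f := by
  obtain ⟨f, rfl⟩ := Submodule.Quotient.mk_surjective _ f
  obtain ⟨g, rfl⟩ := Submodule.Quotient.mk_surjective _ g
  exact freeMap_comp f g

theorem cobLMap_add {X Y : CobL R} (f g : X ⟶ Y) :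
    cobLMap (f + g) = cobLMap f + cobLMap g := by
  obtain ⟨f, rfl⟩ := Submodule.Quotient.mk_surjective _ f
  obtain ⟨g, rfl⟩ := Submodule.Quotient.mk_surjective _ g
  exact (freeMap R X.cob Y.cob).map_add f g

theorem cobLMap_zero (X Y : CobL R) : cobLMap (0 : X ⟶ Y) = 0 :=
  (freeMap R X.cob Y.cob).map_zero

theorem cobLMap_sum {X Y : CobL R} {ι : Type} (s : Finset ι) (f : ι → (X ⟶ Y)) :
    cobLMap (∑ i ∈ s, f i) = ∑ i ∈ s, cobLMap (f i) := by
  classical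
  induction s using Finset.induction_on with
  | empty => simp [cobLMap_zero]
  | insert a s h ih => rw [Finset.sum_insert h, Finset.sum_insert h, cobLMap_add, ih]

/-- The linear map of a matrix of morphisms of `CobL R`. -/
def matMap {ι κ : Type} [Fintype ι] {X : ι → CobL R} {Y : κ → CobL R} (f : ∀ i j, X i ⟶ Y j) :
    (∀ i, ATpow R (X i).cob.circles) →ₗ[R[X]] ∀ j, ATpow R (Y j).cob.circles :=
  LinearMap.pi fun j => ∑ i, cobLMap (f i j) ∘ₗ LinearMap.proj i

instance {I : Type} [Finite I] : Module.Free R[X] (ATpow R I) :=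
  Module.Free.of_basis (Basis.piTensorProduct fun _ => QuadraticAlgebra.basis _ _)

end FT

/-- The category of free `S`-modules of finite rank. -/
abbrev FreeMod (S : Type u) [CommRing S] :=
  ObjectProperty.FullSubcategory fun M : ModuleCat.{u} S => Module.Free S M ∧ Module.Finite S M

/-- The TQFT `F_T`, on finite direct sums of objects: a disjoint union of circles `I` goes to
`⨂ i : I, A_T`, a direct sum to the product, and a matrix of cobordisms to the matrix of their
linear maps. -/
def FT (R : Type u) [CommRing R] : Mat_ (CobL R) ⥤ FreeMod R[X] where
  obj M := ⟨ModuleCat.of R[X] (∀ i : M.ι, ATpow R (M.X i).cob.circles),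
    inferInstanceAs (Module.Free R[X] (∀ i : M.ι, ATpow R (M.X i).cob.circles)),
    inferInstanceAs (Module.Finite R[X] (∀ i : M.ι, ATpow R (M.X i).cob.circles))⟩
  map {M N} f := ObjectProperty.homMk (ModuleCat.ofHom (matMap f))
  map_id M := by
    classical
    refine ObjectProperty.hom_ext _ (ModuleCat.hom_ext (LinearMap.ext fun x => funext fun j => ?_))
    change (∑ i, cobLMap (𝟙 M i j) ∘ₗ LinearMap.proj i) x = x j
    rw [LinearMap.sum_apply, Finset.sum_eq_single j]
    · rw [Mat_.id_apply_self, cobLMap_id]; rfl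
    · intro i _ h
      rw [Mat_.id_apply_of_ne _ _ _ h, cobLMap_zero]; rfl
    · exact fun h => absurd (Finset.mem_univ j) h
  map_comp {M N K} f g := by
    refine ObjectProperty.hom_ext _ (ModuleCat.hom_ext (LinearMap.ext fun x => funext fun k => ?_))
    change (∑ i, cobLMap ((f ≫ g) i k) ∘ₗ LinearMap.proj i) x =
      (∑ j, cobLMap (g j k) ∘ₗ LinearMap.proj j)
        ((LinearMap.pi fun j => ∑ i, cobLMap (f i j) ∘ₗ LinearMap.proj i) x)
    simp only [LinearMap.sum_apply, LinearMap.comp_apply, LinearMap.proj_apply, LinearMap.pi_apply,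
      map_sum, Mat_.comp_apply, cobLMap_sum, cobLMap_comp]
    exact Finset.sum_comm

instance (R : Type u) [CommRing R] : (FT R).Additive where
  map_add {M N f g} := by
    refine ObjectProperty.hom_ext _ (ModuleCat.hom_ext ?_)
    change matMap (fun i j => f i j + g i j) = matMap f + matMap g
    refine LinearMap.ext fun x => funext fun j => ?_
    simp only [matMap, LinearMap.add_apply, Pi.add_apply, LinearMap.pi_apply, LinearMap.sum_apply,
      LinearMap.comp_apply, cobLMap_add, Finset.sum_add_distrib]


/-! ## Link diagrams -/

/-- The half-edges of a 4-valent graph with `n` vertices; `(x, 0), …, (x, 3)` are the half-edges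
at the vertex `x`, in counterclockwise order. -/
abbrev HalfEdge (n : ℕ) := Fin n × Fin 4

/-- The next half-edge at the same vertex, counterclockwise. -/
def HalfEdge.rot {n : ℕ} (h : HalfEdge n) : HalfEdge n := (h.1, h.2 + 1)

/-- The orientation of half-edges: at each crossing the under-strand runs from `0` to `2`,
the over-strand runs from `3` to `1` if the crossing is positive and from `1` to `3` otherwise. -/
def HalfEdge.incoming {n : ℕ} (sign : Fin n → Bool) (h : HalfEdge n) : Bool :=
  ![true, !sign h.1, false, sign h.1] h.2

/-- An oriented link diagram in the plane: `n` crossings, the arcs (edges) which join the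
half-edges in pairs, the signs of the crossings, and a number of circles without crossings.
The underlying 4-valent graph is planar for the given cyclic orders at the vertices: the numbers of
faces (orbits of half-edges under going along an edge and turning), vertices, edges
(there are `2 * n`) and connected components satisfy Euler's formula `V - E + F = 2 C`. -/
structure LinkDiagram where
  n : ℕ
  arc : HalfEdge n → HalfEdge n
  arc_arc : ∀ h, arc (arc h) = h
  sign : Fin n → Bool
  oriented : ∀ h, (arc h).incoming sign = !h.incoming sign
  planar : Nat.card (Quot fun h k : HalfEdge n => k = (arc h).rot) =
    n + 2 * Nat.card (Quot fun h k : HalfEdge n => k = arc h ∨ k = h.rot)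
  loops : ℕ

namespace LinkDiagram

section Shading

/-- The functions invariant under a relation. -/
def invFun {H : Type} (r : H → H → Prop) : Submodule (ZMod 2) (H → ZMod 2) where
  carrier := {φ | ∀ h k, r h k → φ k = φ h}
  add_mem' ha hb h k hr := by simp [ha h k hr, hb h k hr]
  zero_mem' _ _ _ := rfl
  smul_mem' c _ ha h k hr := by simp [ha h k hr]

theorem finrank_invFun {H : Type} [Fintype H] (r : H → H → Prop) :
    Module.finrank (ZMod 2) (invFun r) = Nat.card (Quot r) := by
  classical
  have : Fintype (Quot r) := Fintype.ofFinite _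
  let e : (Quot r → ZMod 2) ≃ₗ[ZMod 2] invFun r :=
    { toFun := fun φ => ⟨fun h => φ (Quot.mk r h), fun h k hr => congrArg φ (Quot.sound hr).symm⟩
      map_add' := fun _ _ => rfl
      map_smul' := fun _ _ => rfl
      invFun := fun φ => Quot.lift φ.1 fun h k hr => (φ.2 h k hr).symm
      left_inv := fun φ => by funext q; induction q using Quot.ind; rfl
      right_inv := fun φ => rfl }
  rw [← e.finrank_eq, Module.finrank_fintype_fun_eq_card, Nat.card_eq_fintype_card]

theorem add_self_two (a : ZMod 2) : a + a = 0 := CharTwo.add_self_eq_zero a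

/-- The half-edges of a diagram have a checkerboard colouring. -/
theorem exists_shading (D : LinkDiagram) : ∃ φ : HalfEdge D.n → ZMod 2,
    (∀ h, φ (D.arc h) = φ h + 1) ∧ ∀ h, φ h.rot = φ h + 1 := by
  classical
  let A := invFun (H := HalfEdge D.n) fun h k => k = D.arc h
  let B := invFun (H := HalfEdge D.n) fun h k => k = (D.arc h).rot
  let C := invFun (H := HalfEdge D.n) fun h k => k = D.arc h ∨ k = h.rot
  have hB := finrank_invFun (H := HalfEdge D.n) fun h k => k = (D.arc h).rot
  have hC := finrank_invFun (H := HalfEdge D.n) fun h k => k = D.arc h ∨ k = h.rot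
  have hH : Module.finrank (ZMod 2) (HalfEdge D.n → ZMod 2) = 4 * D.n := by
    rw [Module.finrank_fintype_fun_eq_card, Fintype.card_prod, Fintype.card_fin, Fintype.card_fin,
      mul_comm]
  have hA : 2 * D.n ≤ Module.finrank (ZMod 2) A := by
    let T : (HalfEdge D.n → ZMod 2) →ₗ[ZMod 2] (HalfEdge D.n → ZMod 2) := LinearMap.id + LinearMap.funLeft _ _ D.arc
    have h1 := T.finrank_range_add_finrank_ker
    have h2 : LinearMap.range T ≤ A := by
      rintro _ ⟨φ, rfl⟩ h k rfl
      change φ (D.arc h) + φ (D.arc (D.arc h)) = φ h + φ (D.arc h)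
      rw [D.arc_arc, add_comm]
    have h3 : LinearMap.ker T ≤ A := by
      rintro φ hφ h k rfl
      have : φ h + φ (D.arc h) = 0 := congrFun hφ h
      exact (CharTwo.add_eq_zero.1 this).symm
    have h4 := Submodule.finrank_mono h2
    have h5 := Submodule.finrank_mono h3
    omega
  have hAB : A ⊓ B ≤ C := by
    rintro φ ⟨h1, h2⟩ h k (rfl | rfl)
    · exact h1 h _ rfl
    · have := h2 (D.arc h) _ rfl
      rw [D.arc_arc] at this
      exact this.trans (h1 h _ rfl)
  let M : Matrix (Fin D.n) (HalfEdge D.n) (ZMod 2) := Matrix.of fun v h =>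
    (if h.1 = v then 1 else 0) + if (D.arc h).1 = v then 1 else 0
  have hM : ∀ (ψ : HalfEdge D.n → ZMod 2) v, (M.mulVecLin ψ) v = ∑ i, (ψ (v, i) + ψ (D.arc (v, i))) := by
    intro ψ v
    have e : ∑ h : HalfEdge D.n, (if (D.arc h).1 = v then ψ h else 0) =
        ∑ h : HalfEdge D.n, if h.1 = v then ψ (D.arc h) else 0 := by
      rw [← Equiv.sum_comp (Function.Involutive.toPerm D.arc D.arc_arc)
        fun h => if (D.arc h).1 = v then ψ h else 0]
      refine Finset.sum_congr rfl fun h _ => ?_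
      change (if (D.arc (D.arc h)).1 = v then ψ (D.arc h) else 0) = _
      rw [D.arc_arc]
    have e' : ∀ χ : HalfEdge D.n → ZMod 2, ∑ h : HalfEdge D.n, (if h.1 = v then χ h else 0) = ∑ i, χ (v, i) := by
      intro χ
      rw [Fintype.sum_prod_type, Finset.sum_eq_single v]
      · simp
      · intro w _ hw; simp [hw]
      · simp
    change ∑ h : HalfEdge D.n, ((if h.1 = v then (1 : ZMod 2) else 0) +
      if (D.arc h).1 = v then 1 else 0) * ψ h = _
    simp only [add_mul, ite_mul, one_mul, zero_mul, Finset.sum_add_distrib]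
    rw [e, e', e' fun h => ψ (D.arc h)]
  have hMt : ∀ (χ : Fin D.n → ZMod 2) h, (M.transpose.mulVecLin χ) h = χ h.1 + χ (D.arc h).1 := by
    intro χ h
    change ∑ v, ((if h.1 = v then (1 : ZMod 2) else 0) +
      if (D.arc h).1 = v then 1 else 0) * χ v = _
    simp [add_mul, Finset.sum_add_distrib]
  have hker : Module.finrank (ZMod 2) (LinearMap.ker M.mulVecLin) ≤
      3 * D.n + Module.finrank (ZMod 2) C := by
    have h1 := M.mulVecLin.finrank_range_add_finrank_ker
    have h2 := M.transpose.mulVecLin.finrank_range_add_finrank_ker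
    have h3 : M.transpose.rank = M.rank := M.rank_transpose
    rw [Module.finrank_fintype_fun_eq_card, Fintype.card_fin] at h2
    rw [hH] at h1
    have h4 : Module.finrank (ZMod 2) (LinearMap.ker M.transpose.mulVecLin) ≤
        Module.finrank (ZMod 2) C := by
      let p : LinearMap.ker M.transpose.mulVecLin →ₗ[ZMod 2] C :=
        { toFun := fun χ => ⟨fun h => χ.1 h.1, by
            rintro h k (rfl | rfl)
            · have : χ.1 h.1 + χ.1 (D.arc h).1 = 0 := by
                rw [← hMt]; exact congrFun χ.2 h
              exact (CharTwo.add_eq_zero.1 this).symm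
            · rfl⟩
          map_add' := fun _ _ => rfl
          map_smul' := fun _ _ => rfl }
      refine LinearMap.finrank_le_finrank_of_injective (f := p) fun χ χ' h => ?_
      refine Subtype.ext (funext fun v => ?_)
      exact congrFun (congrArg Subtype.val h) (v, 0)
    unfold Matrix.rank at h3
    omega
  have hle : B ⊔ A ≤ LinearMap.ker M.mulVecLin := by
    refine sup_le ?_ ?_
    · intro φ hφ
      refine LinearMap.mem_ker.2 (funext fun v => ?_)
      have e : ∀ i, φ (D.arc (v, i)) = φ (v, i + 1) := by
        intro i
        have := hφ (D.arc (v, i)) _ rfl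
        rw [D.arc_arc] at this
        exact this.symm
      rw [hM, Finset.sum_add_distrib]
      simp only [e]
      change _ + ∑ i, φ (v, Equiv.addRight (1 : Fin 4) i) = _
      rw [Equiv.sum_comp (Equiv.addRight (1 : Fin 4)) fun i => φ (v, i), add_self_two]
      rfl
    · intro φ hφ
      refine LinearMap.mem_ker.2 (funext fun v => ?_)
      have e : ∀ i, φ (D.arc (v, i)) = φ (v, i) := fun i => hφ (v, i) _ rfl
      rw [hM]
      simp only [e, add_self_two]
      exact Finset.sum_const_zero
  have heq : B ⊔ A = LinearMap.ker M.mulVecLin := by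
    refine Submodule.eq_of_le_of_finrank_le hle (hker.trans ?_)
    have h1 := Submodule.finrank_sup_add_finrank_inf_eq B A
    have h2 : Module.finrank (ZMod 2) (B ⊓ A : Submodule _ _) ≤ Module.finrank (ZMod 2) C :=
      Submodule.finrank_mono (by rw [inf_comm]; exact hAB)
    have h3 := D.planar
    change Module.finrank (ZMod 2) B = _ at hB
    change Module.finrank (ZMod 2) C = _ at hC
    omega
  let ψ : HalfEdge D.n → ZMod 2 := fun h => if h.incoming D.sign then 1 else 0
  have hψ' : ∀ h, ψ (D.arc h) = ψ h + 1 := by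
    intro h
    change (if (D.arc h).incoming D.sign then (1 : ZMod 2) else 0) =
      (if h.incoming D.sign then 1 else 0) + 1
    rw [D.oriented]
    cases h.incoming D.sign <;> simp [add_self_two]
  have hψ : ψ ∈ B ⊔ A := by
    rw [heq]
    refine LinearMap.mem_ker.2 (funext fun v => ?_)
    rw [hM]
    simp only [hψ', ← add_assoc, add_self_two, zero_add, Finset.sum_const]
    exact (by decide : (Finset.univ : Finset (Fin 4)).card • (1 : ZMod 2) = 0)
  obtain ⟨φ, hφ, α, hα, hs⟩ := Submodule.mem_sup.1 hψ
  have h1 : ∀ h, φ (D.arc h) = φ h + 1 := by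
    intro h
    have e1 : φ h + α h = ψ h := congrFun hs h
    have e2 : φ (D.arc h) + α (D.arc h) = ψ (D.arc h) := congrFun hs (D.arc h)
    rw [hα h _ rfl, hψ', ← e1] at e2
    have := add_right_cancel (e2.trans (add_right_comm (φ h) (α h) 1))
    exact this
  refine ⟨φ, h1, fun h => ?_⟩
  have := hφ (D.arc h) _ rfl
  rw [D.arc_arc] at this
  rw [this, h1]

end Shading

end LinkDiagram

namespace LinkDiagram

/-! ## Smoothings and saddles -/

/-- The other end of the half-edge `i` at a smoothed crossing: the `0`-smoothing joins `0` with `1`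
and `2` with `3`, the `1`-smoothing joins `1` with `2` and `3` with `0`. -/
def turn (b : Bool) (i : Fin 4) : Fin 4 := bif b then ![3, 2, 1, 0] i else ![1, 0, 3, 2] i

/-- The passage through the crossings smoothed according to `s`. -/
def smooth {n : ℕ} (s : Fin n → Bool) (h : HalfEdge n) : HalfEdge n := (h.1, turn (s h.1) h.2)

/-- The components of the union of the arcs (with the circles without crossings) and the
two smoothings `s` and `t` at each crossing. For `s = t` these are the circles of the smoothing;
if `s` and `t` differ at one crossing, they are the components of the
saddle cobordism between the two smoothings. -/
def Strands (D : LinkDiagram) (s t : Fin D.n → Bool) : Type :=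
  Quot fun p q : HalfEdge D.n ⊕ Fin D.loops => ∃ h, p = .inl h ∧
    (q = .inl (D.arc h) ∨ q = .inl (smooth s h) ∨ q = .inl (smooth t h))

namespace Strands

variable {D : LinkDiagram}

/-- The component of a point. -/
def mk (s t : Fin D.n → Bool) (p : HalfEdge D.n ⊕ Fin D.loops) : D.Strands s t := Quot.mk _ p

instance (s t : Fin D.n → Bool) : Fintype (D.Strands s t) := @Fintype.ofFinite _ (Quot.finite _)

theorem mk_arc (s t : Fin D.n → Bool) (h : HalfEdge D.n) :
    mk s t (.inl h) = mk s t (.inl (D.arc h)) := Quot.sound ⟨h, rfl, .inl rfl⟩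

theorem mk_left (s t : Fin D.n → Bool) (h : HalfEdge D.n) :
    mk s t (.inl h) = mk s t (.inl (smooth s h)) := Quot.sound ⟨h, rfl, .inr (.inl rfl)⟩

theorem mk_right (s t : Fin D.n → Bool) (h : HalfEdge D.n) :
    mk s t (.inl h) = mk s t (.inl (smooth t h)) := Quot.sound ⟨h, rfl, .inr (.inr rfl)⟩

theorem mk_between {s t u : Fin D.n → Bool} (hu : ∀ x, u x = s x ∨ u x = t x) (h : HalfEdge D.n) :
    mk s t (.inl h) = mk s t (.inl (smooth u h)) := by
  rcases hu h.1 with e | e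
  · rw [mk_left s t h, smooth, smooth, e]
  · rw [mk_right s t h, smooth, smooth, e]

theorem lift {s t : Fin D.n → Bool} (P : HalfEdge D.n ⊕ Fin D.loops → Prop)
    (ha : ∀ h, P (.inl h) ↔ P (.inl (D.arc h))) (hs : ∀ h, P (.inl h) ↔ P (.inl (smooth s h)))
    (ht : ∀ h, P (.inl h) ↔ P (.inl (smooth t h))) {p q : HalfEdge D.n ⊕ Fin D.loops}
    (e : mk s t p = mk s t q) : P p ↔ P q := by
  have key : ∀ p q : HalfEdge D.n ⊕ Fin D.loops, (∃ h, p = .inl h ∧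
      (q = .inl (D.arc h) ∨ q = .inl (smooth s h) ∨ q = .inl (smooth t h))) → P p = P q := by
    rintro _ _ ⟨h, rfl, rfl | rfl | rfl⟩
    · exact propext (ha h)
    · exact propext (hs h)
    · exact propext (ht h)
  exact iff_of_eq (congrArg (Quot.lift P key) e)

/-- The component of the larger union which contains a component of the smaller one. -/
def map {s t u v : Fin D.n → Bool} (hu : ∀ x, u x = s x ∨ u x = t x)
    (hv : ∀ x, v x = s x ∨ v x = t x) : D.Strands u v → D.Strands s t :=
  Quot.lift (mk s t) (by
    rintro _ _ ⟨h, rfl, rfl | rfl | rfl⟩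
    · exact mk_arc s t h
    · exact mk_between hu h
    · exact mk_between hv h)

theorem exists_mk {s t : Fin D.n → Bool} (c : D.Strands s t) : ∃ p, mk s t p = c :=
  Quot.exists_rep c

/-- The component of the saddle cobordism on which a circle of the smoothing `s` lies. -/
def left (s t : Fin D.n → Bool) : D.Strands s s → D.Strands s t :=
  map (fun _ => .inl rfl) fun _ => .inl rfl

/-- The component of the saddle cobordism on which a circle of the smoothing `t` lies. -/
def right (s t : Fin D.n → Bool) : D.Strands t t → D.Strands s t :=
  map (fun _ => .inr rfl) fun _ => .inr rfl

end Strands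

/-- The cobordism from the smoothing `s` to the smoothing `t`, which differ at one crossing: a saddle
at that crossing (a pair of pants) and cylinders on the circles away from it. -/
def saddle (D : LinkDiagram) (s t : Fin D.n → Bool) :
    Surface (D.Strands s s) (D.Strands t t) where
  Comp := D.Strands s t
  src := Strands.left s t
  tgt := Strands.right s t
  genus _ := 0

section Count

theorem iter_loop {P : Type} (f : P → P) (a b : P) (k : ℕ) (hk : 0 < k) (hb : f^[k] b = b)
    (hab : a ≠ b) (H : ∀ j, 0 < j → j < k → f^[j] b ≠ a) (m : ℕ) : f^[m] b ≠ a := by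
  have e : f^[m] b = f^[m % k] b := (Function.IsPeriodicPt.iterate_mod_apply hb m).symm
  rw [e]
  rcases Nat.eq_zero_or_pos (m % k) with h | h
  · rw [h]; exact hab.symm
  · exact H _ h (Nat.mod_lt _ hk)

theorem iter_back {P : Type} [Finite P] {f : P → P} (hf : Function.Injective f) {a b : P} {m : ℕ}
    (h : f^[m] a = b) : ∃ j, f^[j] b = a := by
  obtain ⟨p, hp, hpa⟩ := hf.mem_periodicPts a
  refine ⟨p * m - m, ?_⟩
  rw [← h, ← Function.iterate_add_apply, Nat.sub_add_cancel (Nat.le_mul_of_pos_left m hp)]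
  exact hpa.mul_const m

theorem iter_xor {P : Type} [Finite P] {f g : P → P} (hf : Function.Injective f) {a b : P}
    (hab : a ≠ b) (S : P → Prop) (hS : ∀ x, S x → S (f x)) (hb : S b)
    (hg : ∀ x, S x → x ≠ a → x ≠ b → g x = f x) (hga : g a = f b) :
    (∃ k, f^[k] a = b) ↔ ¬ ∃ k, g^[k] a = b := by
  classical
  have ex : ∃ k, 0 < k ∧ (f^[k] b = a ∨ f^[k] b = b) := by
    obtain ⟨p, hp, hpb⟩ := hf.mem_periodicPts b
    exact ⟨p, hp, .inr hpb⟩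
  obtain ⟨hk, hk'⟩ := Nat.find_spec ex
  set k := Nat.find ex with hkdef
  have hmin : ∀ j, 0 < j → j < k → f^[j] b ≠ a ∧ f^[j] b ≠ b := by
    intro j h1 h2
    have := Nat.find_min ex h2
    tauto
  have hSj : ∀ j, S (f^[j] b) := by
    intro j
    induction j with
    | zero => exact hb
    | succ j ih => rw [Function.iterate_succ_apply']; exact hS _ ih
  have hgj : ∀ j, j + 1 ≤ k → g^[j + 1] a = f^[j + 1] b := by
    intro j
    induction j with
    | zero => intro _; exact hga
    | succ j ih =>
      intro hj
      have := hmin (j + 1) (by omega) (by omega)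
      rw [Function.iterate_succ_apply', ih (by omega), Function.iterate_succ_apply' f (j + 1),
        hg _ (hSj _) this.1 this.2]
  have hgk : g^[k] a = f^[k] b := by
    have := hgj (k - 1) (by omega)
    rwa [Nat.sub_add_cancel hk] at this
  rcases hk' with h | h
  · refine iff_of_true (iter_back hf h) ?_
    rintro ⟨m, hm⟩
    refine iter_loop g b a k hk (hgk.trans h) hab.symm (fun j h1 h2 => ?_) m hm
    have := hgj (j - 1) (by omega)
    rw [Nat.sub_add_cancel h1] at this
    rw [this]
    exact (hmin j h1 h2).2
  · refine iff_of_false ?_ (not_not.2 ⟨k, hgk.trans h⟩)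
    rintro ⟨m, hm⟩
    obtain ⟨j, hj⟩ := iter_back hf hm
    exact iter_loop f a b k hk h hab (fun j h1 h2 => (hmin j h1 h2).1) j hj

variable {D : LinkDiagram}

theorem smooth_smooth {n : ℕ} (s : Fin n → Bool) (h : HalfEdge n) : smooth s (smooth s h) = h := by
  obtain ⟨x, i⟩ := h
  have : ∀ (b : Bool) (i : Fin 4), turn b (turn b i) = i := by decide
  exact congrArg (Prod.mk x) (this _ _)

theorem shading_smooth {n : ℕ} {φ : HalfEdge n → ZMod 2} (h : ∀ h, φ h.rot = φ h + 1)
    (s : Fin n → Bool) (p : HalfEdge n) : φ (smooth s p) = φ p + 1 := by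
  obtain ⟨x, i⟩ := p
  have h0 : φ (x, 1) = φ (x, 0) + 1 := h (x, 0)
  have h1 : φ (x, 2) = φ (x, 1) + 1 := h (x, 1)
  have h2 : φ (x, 3) = φ (x, 2) + 1 := h (x, 2)
  have h3 : φ (x, 0) = φ (x, 3) + 1 := h (x, 3)
  have h0' : φ (x, 0) = φ (x, 1) + 1 := by rw [h0, add_assoc, add_self_two, add_zero]
  have h1' : φ (x, 1) = φ (x, 2) + 1 := by rw [h1, add_assoc, add_self_two, add_zero]
  have h2' : φ (x, 2) = φ (x, 3) + 1 := by rw [h2, add_assoc, add_self_two, add_zero]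
  have h3' : φ (x, 3) = φ (x, 0) + 1 := by rw [h3, add_assoc, add_self_two, add_zero]
  change φ (x, turn (s x) i) = _
  cases s x <;> fin_cases i
  · exact h0
  · exact h0'
  · exact h2
  · exact h2'
  · exact h3'
  · exact h1
  · exact h1'
  · exact h3

/-- Two half-edges of the same colour lie on the same circle if and only if one is reached from
the other by travelling along the circle. -/
theorem circle_eq_iff {φ : HalfEdge D.n → ZMod 2} (ha : ∀ h, φ (D.arc h) = φ h + 1)
    (hr : ∀ h, φ h.rot = φ h + 1) (s : Fin D.n → Bool) {h k : HalfEdge D.n} (hk : φ k = φ h) :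
    Strands.mk s s (.inl h : HalfEdge D.n ⊕ Fin D.loops) = Strands.mk s s (.inl k) ↔
      ∃ m, (fun p => D.arc (smooth s p))^[m] h = k := by
  classical
  set f : HalfEdge D.n → HalfEdge D.n := fun p => D.arc (smooth s p) with hf
  have hfi : Function.Injective f := fun p q e => by
    rw [← smooth_smooth s p, ← D.arc_arc (smooth s p), ← smooth_smooth s q,
      ← D.arc_arc (smooth s q)]
    exact congrArg (fun x => smooth s (D.arc x)) e
  have hstep : ∀ p, (∃ m, f^[m] h = p) ↔ ∃ m, f^[m] h = f p := by
    intro p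
    constructor
    · rintro ⟨m, rfl⟩; exact ⟨m + 1, Function.iterate_succ_apply' f m h⟩
    · rintro ⟨m, hm⟩
      have h1 : f^[1] p = f p := rfl
      obtain ⟨j, hj⟩ := iter_back hfi h1
      exact ⟨j + m, by rw [Function.iterate_add_apply, hm, hj]⟩
  have two : ∀ a b : ZMod 2, a ≠ b → a + 1 = b := by decide
  have two' : ∀ a b : ZMod 2, a = b → a + 1 ≠ b := by decide
  constructor
  · intro e
    let Q : HalfEdge D.n → Prop := fun p =>
      if φ p = φ h then ∃ m, f^[m] h = p else ∃ m, f^[m] h = D.arc p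
    have hQa : ∀ p, Q p ↔ Q (D.arc p) := by
      intro p
      simp only [Q, ha]
      by_cases c : φ p = φ h
      · rw [if_pos c, if_neg (two' _ _ c), D.arc_arc]
      · rw [if_neg c, if_pos (two _ _ c)]
    have hQs : ∀ p, Q p ↔ Q (smooth s p) := by
      intro p
      simp only [Q, shading_smooth hr]
      by_cases c : φ p = φ h
      · rw [if_pos c, if_neg (two' _ _ c)]
        exact hstep p
      · rw [if_neg c, if_pos (two _ _ c)]
        refine Iff.trans ?_ (hstep (smooth s p)).symm
        change _ ↔ ∃ m, f^[m] h = D.arc (smooth s (smooth s p))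
        rw [smooth_smooth]
    have := (Strands.lift (Sum.elim Q fun _ => False) hQa hQs hQs e).1
      (by simp only [Sum.elim_inl, Q, if_pos]; exact ⟨0, rfl⟩)
    simpa only [Sum.elim_inl, Q, if_pos hk] using this
  · rintro ⟨m, rfl⟩
    clear hk
    induction m with
    | zero => rfl
    | succ m ih =>
      rw [ih, Function.iterate_succ_apply']
      exact (Strands.mk_left s s _).trans (Strands.mk_arc s s _)

/-- Passing from one smoothing to the other at `x` joins the two circles at `x`, or
separates the circle at `x` into two. -/
theorem circle_xor {s t : Fin D.n → Bool} {x : Fin D.n} (hx : s x ≠ t x)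
    (hst : ∀ y, y ≠ x → s y = t y) :
    Strands.mk s s (.inl (x, 0) : HalfEdge D.n ⊕ Fin D.loops) = Strands.mk s s (.inl (x, 2)) ↔
      Strands.mk t t (.inl (x, 0) : HalfEdge D.n ⊕ Fin D.loops) ≠ Strands.mk t t (.inl (x, 2)) := by
  obtain ⟨φ, ha, hr⟩ := D.exists_shading
  have h1 : φ (x, 1) = φ (x, 0) + 1 := hr (x, 0)
  have h2 : φ (x, 2) = φ (x, 1) + 1 := hr (x, 1)
  have h3 : φ (x, 3) = φ (x, 2) + 1 := hr (x, 2)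
  have h20 : φ (x, 2) = φ (x, 0) := by rw [h2, h1, add_assoc, add_self_two, add_zero]
  have ne : ∀ a : ZMod 2, a + 1 ≠ a := by decide
  rw [Ne, circle_eq_iff ha hr s h20, circle_eq_iff ha hr t h20]
  refine iter_xor ?_ (fun e => by simpa using congrArg Prod.snd e) (fun p => φ p = φ (x, 0)) ?_
    h20 ?_ ?_
  · intro p q e
    have e' : D.arc (D.arc (smooth s p)) = D.arc (D.arc (smooth s q)) := congrArg D.arc e
    rw [D.arc_arc, D.arc_arc] at e'
    rw [← smooth_smooth s p, e', smooth_smooth]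
  · intro p hp
    rw [ha, shading_smooth hr, hp, add_assoc, add_self_two, add_zero]
  · rintro ⟨y, i⟩ hp hp0 hp2
    have hy : y ≠ x := by
      rintro rfl
      fin_cases i
      · exact hp0 rfl
      · exact ne _ (h1.symm.trans hp)
      · exact hp2 rfl
      · exact ne _ ((h20 ▸ h3).symm.trans hp)
    change D.arc (y, turn (t y) i) = D.arc (y, turn (s y) i)
    rw [hst y hy]
  · change D.arc (x, turn (t x) 0) = D.arc (x, turn (s x) 2)
    revert hx
    cases s x <;> cases t x <;> intro hx
    · exact absurd rfl hx
    · rfl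
    · rfl
    · exact absurd rfl hx

theorem mk_cross (u : Fin D.n → Bool) (x : Fin D.n) (i : Fin 4) :
    Strands.mk u u (.inl (x, i) : HalfEdge D.n ⊕ Fin D.loops) = Strands.mk u u (.inl (x, 0)) ∨
      Strands.mk u u (.inl (x, i) : HalfEdge D.n ⊕ Fin D.loops) = Strands.mk u u (.inl (x, 2)) := by
  have h := Strands.mk_left u u ((x, i) : HalfEdge D.n)
  rw [smooth] at h
  revert h
  simp only
  cases u x <;> fin_cases i <;> intro h
  · exact .inl rfl
  · exact .inl h
  · exact .inr rfl
  · exact .inr h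
  · exact .inl rfl
  · exact .inr h
  · exact .inr rfl
  · exact .inl h

theorem mk_saddle {s t : Fin D.n → Bool} {x : Fin D.n} (hx : s x ≠ t x) :
    Strands.mk s t (.inl (x, 2) : HalfEdge D.n ⊕ Fin D.loops) = Strands.mk s t (.inl (x, 0)) := by
  have h1 := Strands.mk_left s t ((x, 2) : HalfEdge D.n)
  have h2 := Strands.mk_right s t ((x, 2) : HalfEdge D.n)
  have h3 := Strands.mk_left s t ((x, 0) : HalfEdge D.n)
  have h4 := Strands.mk_right s t ((x, 0) : HalfEdge D.n)
  rw [smooth] at h1 h2 h3 h4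
  revert h1 h2 h3 h4 hx
  simp only
  cases s x <;> cases t x <;> intro hx h1 h2 h3 h4
  · exact absurd rfl hx
  · exact h1.trans h4.symm
  · exact h2.trans h3.symm
  · exact absurd rfl hx

theorem mk_eq_or {s t u : Fin D.n → Bool} {x : Fin D.n} (hs : ∀ y, y ≠ x → s y = u y)
    (ht : ∀ y, y ≠ x → t y = u y) {p q : HalfEdge D.n ⊕ Fin D.loops}
    (e : Strands.mk s t p = Strands.mk s t q) :
    Strands.mk u u p = Strands.mk u u q ∨
      (Strands.mk u u p = Strands.mk u u (.inl (x, 0)) ∨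
        Strands.mk u u p = Strands.mk u u (.inl (x, 2))) ∧
      (Strands.mk u u q = Strands.mk u u (.inl (x, 0)) ∨
        Strands.mk u u q = Strands.mk u u (.inl (x, 2))) := by
  let P : HalfEdge D.n ⊕ Fin D.loops → Prop := fun p => Strands.mk u u p = Strands.mk u u q ∨
      (Strands.mk u u p = Strands.mk u u (.inl (x, 0)) ∨
        Strands.mk u u p = Strands.mk u u (.inl (x, 2))) ∧
      (Strands.mk u u q = Strands.mk u u (.inl (x, 0)) ∨
        Strands.mk u u q = Strands.mk u u (.inl (x, 2)))
  have key : ∀ v : Fin D.n → Bool, (∀ y, y ≠ x → v y = u y) →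
      ∀ h, P (.inl h) ↔ P (.inl (smooth v h)) := by
    rintro v hv ⟨y, i⟩
    by_cases hy : y = x
    · subst hy
      have h1 := mk_cross u y i
      have h2 := mk_cross u y (turn (v y) i)
      constructor
      · rintro (h | h)
        · exact .inr ⟨h2, h ▸ h1⟩
        · exact .inr ⟨h2, h.2⟩
      · rintro (h | h)
        · exact .inr ⟨h1, h ▸ h2⟩
        · exact .inr ⟨h1, h.2⟩
    · have : smooth v (y, i) = smooth u (y, i) := by simp only [smooth, hv y hy]
      simp only [P, this, ← Strands.mk_left u u (y, i)]
  exact (Strands.lift P (fun h => by simp only [P, ← Strands.mk_arc u u h]) (key s hs) (key t ht)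
    e).2 (.inl rfl)

open Classical in
theorem fib_circle {s t u : Fin D.n → Bool} {x : Fin D.n} (hx : s x ≠ t x)
    (hs : ∀ y, y ≠ x → s y = u y) (ht : ∀ y, y ≠ x → t y = u y)
    (hu : ∀ y, u y = s y ∨ u y = t y) (c : D.Strands s t) :
    fibSum (Strands.map hu hu) 1 c = 1 + if c = Strands.mk s t (.inl (x, 0)) ∧
      Strands.mk u u (.inl (x, 0) : HalfEdge D.n ⊕ Fin D.loops) ≠ Strands.mk u u (.inl (x, 2))
      then 1 else 0 := by
  obtain ⟨p, rfl⟩ := Strands.exists_mk c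
  simp only [fibSum, Pi.one_apply, Finset.sum_const, smul_eq_mul, mul_one]
  by_cases hc : Strands.mk s t p = Strands.mk s t (.inl (x, 0))
  · have e : (Finset.univ.filter fun v => Strands.map hu hu v = Strands.mk s t p) =
        {Strands.mk u u (.inl (x, 0)), Strands.mk u u (.inl (x, 2))} := by
      ext v
      obtain ⟨q, rfl⟩ := Strands.exists_mk v
      simp only [Finset.mem_filter, Finset.mem_univ, true_and, Finset.mem_insert,
        Finset.mem_singleton, hc]
      constructor
      · intro h
        rcases mk_eq_or hs ht h with h | h
        · exact .inl h
        · exact h.1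
      · rintro (h | h)
        · rw [h]; rfl
        · rw [h]; exact mk_saddle hx
    rw [e]
    by_cases h : Strands.mk u u (.inl (x, 0) : HalfEdge D.n ⊕ Fin D.loops) =
      Strands.mk u u (.inl (x, 2))
    · rw [if_neg fun h' => h'.2 h, h, Finset.pair_eq_singleton, Finset.card_singleton]
    · rw [if_pos ⟨hc, h⟩, Finset.card_pair h]
  · have e : (Finset.univ.filter fun v => Strands.map hu hu v = Strands.mk s t p) =
        {Strands.mk u u p} := by
      ext v
      obtain ⟨q, rfl⟩ := Strands.exists_mk v
      simp only [Finset.mem_filter, Finset.mem_univ, true_and, Finset.mem_singleton]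
      constructor
      · intro h
        rcases mk_eq_or hs ht h with h | ⟨-, h⟩
        · exact h
        · refine absurd ?_ hc
          rcases h with h | h
          · exact congrArg (Strands.map hu hu) h
          · exact (congrArg (Strands.map hu hu) h).trans (mk_saddle hx)
      · intro h
        rw [h]; rfl
    rw [if_neg fun h' => hc h'.1, e, Finset.card_singleton]

open Classical in
/-- The Euler characteristic of each component of a saddle cobordism. -/
theorem fib_saddle {s t : Fin D.n → Bool} {x : Fin D.n} (hx : s x ≠ t x)
    (hst : ∀ y, y ≠ x → s y = t y) {K : Type} (m : D.Strands s t → K) (k : K) :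
    fibSum (fun e => m (Strands.left s t e)) 1 k + fibSum (fun e => m (Strands.right s t e)) 1 k
      = 2 * fibSum m 1 k + if m (Strands.mk s t (.inl (x, 0))) = k then 1 else 0 := by
  have h : fibSum (Strands.left s t) 1 + fibSum (Strands.right s t) 1 =
      1 + 1 + fun c => if c = Strands.mk s t (.inl (x, 0)) then 1 else 0 := by
    funext c
    have h1 := fib_circle (u := s) hx (fun _ _ => rfl) (fun y hy => (hst y hy).symm)
      (fun _ => .inl rfl) c
    have h2 := fib_circle (u := t) hx hst (fun _ _ => rfl) (fun _ => .inr rfl) c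
    have h3 := circle_xor hx hst
    refine (congrArg₂ (· + ·) h1 h2).trans ?_
    simp only [Pi.add_apply, Pi.one_apply]
    by_cases hc : c = Strands.mk s t (.inl (x, 0))
    · simp only [hc, true_and, if_true]
      by_cases h : Strands.mk s s (.inl (x, 0) : HalfEdge D.n ⊕ Fin D.loops) =
        Strands.mk s s (.inl (x, 2))
      · rw [if_neg (not_not.2 h), if_pos (h3.1 h)]
      · rw [if_pos h, if_neg fun h' => h (h3.2 h')]
    · simp only [hc, false_and, if_false]
  have h' := congrArg (fun w => fibSum m w k) h
  simp only [fibSum_add, fibSum_comp] at h'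
  have e : fibSum m (fun c => if c = Strands.mk s t (.inl (x, 0)) then 1 else 0) k =
      if m (Strands.mk s t (.inl (x, 0))) = k then 1 else 0 := by
    simp only [fibSum, Finset.sum_ite_eq', Finset.mem_filter, Finset.mem_univ, true_and]
  change fibSum (fun e => m (Strands.left s t e)) (fun _ => 1) k +
    fibSum (fun e => m (Strands.right s t e)) (fun _ => 1) k = _ at h'
  change fibSum (fun e => m (Strands.left s t e)) (fun _ => 1) k +
    fibSum (fun e => m (Strands.right s t e)) (fun _ => 1) k = _
  rw [h', e]; ring

end Count

end LinkDiagram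

theorem IsGlue.exists_genus {V E K : Type} [Fintype V] [Fintype E] {s t : E → V} (g : V → ℕ)
    {f : V → K} (surj : Function.Surjective f) (eq : ∀ e, f (s e) = f (t e))
    (lift : ∀ h : V → Prop, (∀ e, h (s e) ↔ h (t e)) → ∀ v w, f v = f w → (h v → h w)) :
    ∃ γ : K → ℕ, IsGlue s t g f γ := by
  refine ⟨fun k => fibSum f g k + fibSum (fun e => f (s e)) 1 k + 1 - fibSum f 1 k,
    surj, eq, lift, fun k => ?_⟩
  obtain ⟨v, rfl⟩ := surj k
  have h1 : ∀ w, f w = f v ↔ Glued.mk s t w = Glued.mk s t v := fun w =>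
    ⟨fun h => lift (fun x => Glued.mk s t x = Glued.mk s t v)
      (fun e => by rw [(isGlue_glued s t g).eq e]) v w h.symm rfl,
     fun h => (glued_lift s t (fun x => f x = f v) (fun e => by rw [eq e]) w v h).2 rfl⟩
  have h2 := card_le_glued s t (Glued.mk s t v)
  have h3 : fibSum (Glued.mk s t) 1 (Glued.mk s t v) = fibSum f 1 (f v) := by
    classical
    simp only [fibSum, h1]
  have h4 : fibSum (fun e => Glued.mk s t (s e)) 1 (Glued.mk s t v) =
      fibSum (fun e => f (s e)) 1 (f v) := by
    classical
    simp only [fibSum, h1]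
  omega

namespace LinkDiagram

variable {D : LinkDiagram}

open Classical in
/-- The composite of two saddles at different crossings. -/
theorem saddle_glue {s u t : Fin D.n → Bool} {x y : Fin D.n} (hxy : x ≠ y) (hx : s x ≠ u x)
    (hsu : ∀ z, z ≠ x → s z = u z) (hy : u y ≠ t y) (hut : ∀ z, z ≠ y → u z = t z) :
    ∃ γ : D.Strands s t → ℕ, Surface.Homeo ((D.saddle s u).glue (D.saddle u t))
      ⟨D.Strands s t, Strands.left s t, Strands.right s t, γ⟩ ∧
      ∀ k, 2 * γ k + fibSum (Strands.left s t) 1 k + fibSum (Strands.right s t) 1 k =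
        2 + (if Strands.mk s t (.inl (x, 0)) = k then 1 else 0) +
          if Strands.mk s t (.inl (y, 0)) = k then 1 else 0 := by
  have hu : ∀ z, u z = s z ∨ u z = t z := by
    intro z
    by_cases h : z = x
    · exact .inr (hut z (h ▸ hxy))
    · exact .inl (hsu z h).symm
  let m : D.Strands s u → D.Strands s t := Strands.map (fun _ => .inl rfl) hu
  let m' : D.Strands u t → D.Strands s t := Strands.map hu fun _ => .inr rfl
  obtain ⟨γ, hγ⟩ := IsGlue.exists_genus (V := D.Strands s u ⊕ D.Strands u t)
    (s := fun j => Sum.inl (Strands.right s u j)) (t := fun j => Sum.inr (Strands.left u t j))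
    (Sum.elim (fun _ => 0) fun _ => 0) (f := Sum.elim m m')
    (fun c => by
      obtain ⟨p, rfl⟩ := Strands.exists_mk c
      exact ⟨.inl (Strands.mk s u p), rfl⟩)
    (fun e => by
      obtain ⟨p, rfl⟩ := Strands.exists_mk e
      rfl)
    (fun h hh => by
      let P : HalfEdge D.n ⊕ Fin D.loops → Prop := fun p => h (.inl (Strands.mk s u p))
      have hP : ∀ p, P p ↔ h (.inr (Strands.mk u t p)) := fun p => hh (Strands.mk u u p)
      have key : ∀ v : D.Strands s u ⊕ D.Strands u t, ∃ p, (h v ↔ P p) ∧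
          Sum.elim m m' v = Strands.mk s t p := by
        rintro (v | v)
        · obtain ⟨p, rfl⟩ := Strands.exists_mk v
          exact ⟨p, Iff.rfl, rfl⟩
        · obtain ⟨p, rfl⟩ := Strands.exists_mk v
          exact ⟨p, (hP p).symm, rfl⟩
      intro v w hvw
      obtain ⟨p, hp, hp'⟩ := key v
      obtain ⟨q, hq, hq'⟩ := key w
      rw [hp, hq]
      refine (Strands.lift P (fun e => ?_) (fun e => ?_) (fun e => ?_)
        (hp'.symm.trans (hvw.trans hq'))).1
      · simp only [P, ← Strands.mk_arc s u e]
      · simp only [P, ← Strands.mk_left s u e]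
      · rw [hP, hP, ← Strands.mk_right u t e])
  refine ⟨γ, Surface.glue_homeo _ _ _ (Sum.elim m m') hγ (fun i => ?_) (fun i => ?_), fun k => ?_⟩
  · obtain ⟨p, rfl⟩ := Strands.exists_mk i
    rfl
  · obtain ⟨p, rfl⟩ := Strands.exists_mk i
    rfl
  · have h1 := hγ.genus k
    have h2 := fib_saddle hx hsu m k
    have h3 := fib_saddle hy hut m' k
    have e1 : (fun e => m (Strands.left s u e)) = Strands.left s t := funext fun e => by
      obtain ⟨p, rfl⟩ := Strands.exists_mk e
      rfl
    have e2 : (fun e => m' (Strands.right u t e)) = Strands.right s t := funext fun e => by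
      obtain ⟨p, rfl⟩ := Strands.exists_mk e
      rfl
    have e3 : (fun e => m' (Strands.left u t e)) = fun e => m (Strands.right s u e) :=
      funext fun e => by
        obtain ⟨p, rfl⟩ := Strands.exists_mk e
        rfl
    have e4 : fibSum (Sum.elim m m') (Sum.elim (fun _ => 0) fun _ => 0) k = 0 := by
      rw [fibSum_sum]
      simp [fibSum]
    have e5 : fibSum (Sum.elim m m') 1 k = fibSum m 1 k + fibSum m' 1 k := fibSum_sum _ _ _
    rw [e1] at h2
    rw [e2, e3] at h3
    rw [e4, e5] at h1
    simp only [Sum.elim_inl] at h1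
    change _ = _ + if Strands.mk s t (.inl (x, 0)) = k then 1 else 0 at h2
    change _ = _ + if Strands.mk s t (.inl (y, 0)) = k then 1 else 0 at h3
    omega

/-- Saddles at different crossings commute. -/
theorem saddle_comm {s u u' t : Fin D.n → Bool} {x y : Fin D.n} (hxy : x ≠ y) (hx : s x ≠ u x)
    (hsu : ∀ z, z ≠ x → s z = u z) (hy : u y ≠ t y) (hut : ∀ z, z ≠ y → u z = t z)
    (hy' : s y ≠ u' y) (hsu' : ∀ z, z ≠ y → s z = u' z) (hx' : u' x ≠ t x)
    (hut' : ∀ z, z ≠ x → u' z = t z) :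
    Surface.Homeo ((D.saddle s u).glue (D.saddle u t)) ((D.saddle s u').glue (D.saddle u' t)) := by
  obtain ⟨γ, h, hγ⟩ := saddle_glue hxy hx hsu hy hut
  obtain ⟨γ', h', hγ'⟩ := saddle_glue hxy.symm hy' hsu' hx' hut'
  have e : γ = γ' := funext fun k => by
    have h1 := hγ k
    have h2 := hγ' k
    omega
  subst e
  exact Surface.homeo_equivalence.trans h (Surface.homeo_equivalence.symm h')

/-! ## The geometric complex -/

theorem homL_comp_eq (R : Type u) [CommRing R] {X Y Y' Z : Cob} {S : Surface X.circles Y.circles}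
    {S' : Surface Y.circles Z.circles} {T : Surface X.circles Y'.circles}
    {T' : Surface Y'.circles Z.circles} (h : Surface.Homeo (S.glue S') (T.glue T')) :
    S.homL R ≫ S'.homL R = T.homL R ≫ T'.homL R := by
  have h1 : S.hom ≫ S'.hom = T.hom ≫ T'.hom := Quotient.sound h
  change Submodule.Quotient.mk (freeComp R X Y Z (S.free R) (S'.free R)) =
    Submodule.Quotient.mk (freeComp R X Y' Z (T.free R) (T'.free R))
  unfold Surface.free
  rw [freeComp_single, freeComp_single, h1]

/-- The number of `1`-smoothings. -/
def ones {n : ℕ} (s : Fin n → Bool) : ℕ := (Finset.univ.filter fun x => s x = true).card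

/-- The number of negative crossings. -/
def neg (D : LinkDiagram) : ℕ := (Finset.univ.filter fun x => D.sign x = false).card

/-- The sign of the edge of the cube at the vertex `s` in the direction `x`. -/
def edgeSign {n : ℕ} (s : Fin n → Bool) (x : Fin n) : ℤ :=
  (-1) ^ (Finset.univ.filter fun y => y < x ∧ s y = true).card

/-- A vertex of the cube of resolutions. -/
def resolution (R : Type u) [CommRing R] (D : LinkDiagram) (s : Fin D.n → Bool) : CobL R :=
  ⟨⟨D.Strands s s⟩⟩

/-- The saddle as a morphism. -/
def saddleHom (R : Type u) [CommRing R] (D : LinkDiagram) (s t : Fin D.n → Bool) :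
    D.resolution R s ⟶ D.resolution R t :=
  Surface.homL R (X := ⟨D.Strands s s⟩) (Y := ⟨D.Strands t t⟩) (D.saddle s t)

/-- The edges of the cube of resolutions: a signed saddle from `s` to `t` if `t` arises from `s` by
changing one `0`-smoothing to a `1`-smoothing, and `0` otherwise. -/
def edge (R : Type u) [CommRing R] (D : LinkDiagram) (s t : Fin D.n → Bool) :
    D.resolution R s ⟶ D.resolution R t :=
  ∑ x, if s x = false ∧ t = Function.update s x true then edgeSign s x • D.saddleHom R s t else 0

theorem edgeSign_anti {n : ℕ} (s : Fin n → Bool) {x y : Fin n} (h : x < y) (hx : s x = false) :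
    edgeSign s x * edgeSign (Function.update s x true) y +
      edgeSign s y * edgeSign (Function.update s y true) x = 0 := by
  have h1 : (Finset.univ.filter fun z => z < y ∧ Function.update s x true z = true) =
      insert x (Finset.univ.filter fun z => z < y ∧ s z = true) := by
    ext z
    by_cases hz : z = x
    · subst hz; simp [h]
    · simp [hz]
  have h2 : (Finset.univ.filter fun z => z < x ∧ Function.update s y true z = true) =
      Finset.univ.filter fun z => z < x ∧ s z = true := by
    ext z
    simp only [Finset.mem_filter, Finset.mem_univ, true_and]
    refine and_congr_right fun hz => ?_
    rw [Function.update_of_ne (ne_of_lt (hz.trans h))]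
  have h3 : x ∉ Finset.univ.filter fun z => z < y ∧ s z = true := by simp [hx]
  unfold edgeSign
  rw [h1, h2, Finset.card_insert_of_notMem h3, pow_succ]
  ring

theorem edge_comp_edge (R : Type u) [CommRing R] (D : LinkDiagram) (s t : Fin D.n → Bool) :
    ∑ u, D.edge R s u ≫ D.edge R u t = 0 := by
  classical
  let A : Fin D.n → Fin D.n → (D.resolution R s ⟶ D.resolution R t) := fun x y =>
    if s x = false ∧ Function.update s x true y = false ∧
        t = Function.update (Function.update s x true) y true then
      (edgeSign s x * edgeSign (Function.update s x true) y) •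
        (D.saddleHom R s (Function.update s x true) ≫ D.saddleHom R (Function.update s x true) t)
    else 0
  have h1 : ∑ u, D.edge R s u ≫ D.edge R u t = ∑ x, ∑ y, A x y := by
    have : ∀ u, D.edge R s u ≫ D.edge R u t = ∑ x, ∑ y,
        if u = Function.update s x true then
          (if s x = false ∧ u y = false ∧ t = Function.update u y true then
            (edgeSign s x * edgeSign u y) • (D.saddleHom R s u ≫ D.saddleHom R u t) else 0)
        else 0 := by
      intro u
      unfold edge
      rw [Preadditive.sum_comp]
      refine Finset.sum_congr rfl fun x _ => ?_
      rw [Preadditive.comp_sum]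
      refine Finset.sum_congr rfl fun y _ => ?_
      by_cases hu : u = Function.update s x true
      · by_cases hs : s x = false
        · rw [if_pos ⟨hs, hu⟩, if_pos hu]
          by_cases ht : u y = false ∧ t = Function.update u y true
          · rw [if_pos ht, if_pos ⟨hs, ht⟩, Preadditive.zsmul_comp, Preadditive.comp_zsmul,
              smul_smul]
          · rw [if_neg ht, if_neg fun h => ht h.2, Limits.comp_zero]
        · have e1 : ¬ (s x = false ∧ u = Function.update s x true) := fun h => hs h.1
          have e2 : ¬ (s x = false ∧ u y = false ∧ t = Function.update u y true) := fun h => hs h.1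
          rw [if_neg e1, if_pos hu, if_neg e2, Limits.zero_comp]
      · rw [if_neg fun h => hu h.2, if_neg hu, Limits.zero_comp]
    simp only [this]
    rw [Finset.sum_comm]
    refine Finset.sum_congr rfl fun x _ => ?_
    rw [Finset.sum_comm]
    refine Finset.sum_congr rfl fun y _ => ?_
    rw [Finset.sum_ite_eq' Finset.univ (Function.update s x true), if_pos (Finset.mem_univ _)]
  have h2 : ∀ x y, x < y → A x y + A y x = 0 := by
    intro x y h
    have hne := ne_of_lt h
    have c : (s x = false ∧ Function.update s x true y = false ∧
        t = Function.update (Function.update s x true) y true) ↔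
        (s y = false ∧ Function.update s y true x = false ∧
        t = Function.update (Function.update s y true) x true) := by
      rw [Function.update_of_ne hne.symm, Function.update_of_ne hne, Function.update_comm hne]
      tauto
    simp only [A]
    by_cases hc : s x = false ∧ Function.update s x true y = false ∧
        t = Function.update (Function.update s x true) y true
    · rw [if_pos hc, if_pos (c.1 hc)]
      have e : D.saddleHom R s (Function.update s x true) ≫
          D.saddleHom R (Function.update s x true) t =
          D.saddleHom R s (Function.update s y true) ≫
          D.saddleHom R (Function.update s y true) t := by
        obtain ⟨a1, a2, a3⟩ := hc
        obtain ⟨b1, b2, b3⟩ := c.1 ⟨a1, a2, a3⟩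
        have := saddle_comm (D := D) (s := s) (u := Function.update s x true)
          (u' := Function.update s y true) (t := t) hne
          (by rw [Function.update_self, a1]; decide)
          (fun z hz => (Function.update_of_ne hz _ _).symm)
          (by rw [a2, a3, Function.update_self]; decide)
          (fun z hz => by rw [a3, Function.update_of_ne hz])
          (by rw [Function.update_self, b1]; decide)
          (fun z hz => (Function.update_of_ne hz _ _).symm)
          (by rw [b2, b3, Function.update_self]; decide)
          (fun z hz => by rw [b3, Function.update_of_ne hz])
        exact homL_comp_eq R (X := ⟨D.Strands s s⟩) (Z := ⟨D.Strands t t⟩) this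
      rw [e, ← add_smul, edgeSign_anti s h hc.1, zero_smul]
    · rw [if_neg hc, if_neg fun h => hc (c.2 h), add_zero]
  have h3 : ∀ x, A x x = 0 := fun x => if_neg fun h => by
    have := h.2.1
    rw [Function.update_self] at this
    exact absurd this (by decide)
  rw [h1, ← Finset.sum_product']
  refine Finset.sum_involution (fun p _ => (p.2, p.1)) ?_ ?_ ?_ ?_
  · rintro ⟨x, y⟩ -
    rcases lt_trichotomy x y with h | h | h
    · exact h2 x y h
    · subst h; simp only [h3, add_zero]
    · rw [add_comm]; exact h2 y x h
  · rintro ⟨x, y⟩ - h e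
    have : y = x := congrArg Prod.fst e
    subst this
    exact h (h3 y)
  · exact fun _ _ => Finset.mem_univ _
  · exact fun _ _ => rfl

theorem edge_eq_zero (R : Type u) [CommRing R] (D : LinkDiagram) {s t : Fin D.n → Bool}
    (h : ones t ≠ ones s + 1) : D.edge R s t = 0 := by
  refine Finset.sum_eq_zero fun x _ => if_neg ?_
  rintro ⟨hx, rfl⟩
  refine h ?_
  have e : (Finset.univ.filter fun z => Function.update s x true z = true) =
      insert x (Finset.univ.filter fun z => s z = true) := by
    ext z
    by_cases hz : z = x
    · subst hz; simp
    · simp [hz]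
  rw [ones, e, Finset.card_insert_of_notMem (by simp [hx]), ones]

/-- The geometric complex (formal Khovanov bracket) of a link diagram. In degree `i` it is the formal
direct sum of the smoothings with `i + n₋` `1`-smoothings, where `n₋` is the number of
negative crossings; the differential is the matrix of signed saddles. -/
def complex (R : Type u) [CommRing R] (D : LinkDiagram) :
    CochainComplex (Mat_ (CobL R)) ℤ where
  X i := ⟨{s : Fin D.n → Bool // (ones s : ℤ) - D.neg = i}, fun s => D.resolution R s.1⟩
  d i j := fun s t => D.edge R s.1 t.1
  shape i j hij := by
    funext s t
    refine D.edge_eq_zero R fun h => hij ?_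
    have hs := s.2
    have ht := t.2
    simp only [ComplexShape.up_Rel]
    omega
  d_comp_d' i j k hij _ := by
    classical
    funext s t
    change ∑ u : {u : Fin D.n → Bool // (ones u : ℤ) - D.neg = j},
      D.edge R s.1 u.1 ≫ D.edge R u.1 t.1 = 0
    rw [← D.edge_comp_edge R s.1 t.1, ← Finset.sum_subtype
      (Finset.univ.filter fun u : Fin D.n → Bool => (ones u : ℤ) - D.neg = j) (by simp)
      fun u => D.edge R s.1 u ≫ D.edge R u t.1]
    refine Finset.sum_subset (Finset.subset_univ _) fun u _ hu => ?_
    rw [D.edge_eq_zero R, Limits.zero_comp]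
    intro h
    have hs := s.2
    simp only [ComplexShape.up_Rel] at hij
    refine hu (Finset.mem_filter.2 ⟨Finset.mem_univ _, ?_⟩)
    omega

end LinkDiagram

end GeomLink

end

/-!
The theorem holds because `FT R` is an equivalence of categories when `2` is invertible: then
`G` is an inverse of `FT R` followed by `F`, and `F` is isomorphic to `FT R ⋙ G`, from which
the assertions about complexes follow.

The relation 4Tu with the first two sites on one component and the last two on another says that
twice a tube is the sum of a handle at either end (`homL_neck`). So a boundary circle can be cut off
from its component by a disc, up to a factor `2` and handles, and as `2` is invertible every
morphism of `CobL R` is a linear combination of composites through the empty manifold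
(`homL_mem_span_comp`). Applied to the identities, this reduces the bijectivity of `FT R` on
morphisms to that on the endomorphisms of the empty manifold.

These are the linear combinations of closed surfaces. Write `Σ_g` for the closed connected surface
of genus `g`. Neck cutting gives `2 Σ_(g+h) = Σ_(h+1) Σ_g + Σ_h Σ_(g+1)`; with `Σ_0 = 0` and
`Σ_1 = 2` this yields `Σ_2 = 0` and `2 Σ_(g+2) = Σ_3 Σ_g`, so that `Σ_3` generates the algebra of
endomorphisms (`mem_adjoin_closedConn`). The TQFT sends `Σ_3` to multiplication by `8 T` on a free
module of rank one over `R[T]`, so it identifies this algebra with `R[T]`.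

Finally, a free module of rank `n` is the image of the direct sum of `n` empty manifolds.
-/

namespace GeomLink

/-! ### Recognizing glued surfaces -/

section Recognition

variable {V E K : Type} [Fintype V] [Fintype E]

/-- Nothing is glued. -/
theorem IsGlue.of_isEmpty [IsEmpty E] {s t : E → V} {g : V → ℕ} {f : V → K} {γ : K → ℕ}
    (hf : f.Bijective) (hγ : ∀ v, γ (f v) = g v) : IsGlue s t g f γ where
  surj := hf.2
  eq e := isEmptyElim e
  lift h _ v w hvw hv := hf.1 hvw ▸ hv
  genus k := by
    obtain ⟨v, rfl⟩ := hf.2 k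
    rw [fibSum_inj f hf.1, fibSum_inj f hf.1, hγ]
    simp [fibSum]

/-- A tube from a component to itself raises its genus by one. -/
theorem IsGlue.self [DecidableEq V] (a : V) {g : V → ℕ} :
    IsGlue (fun _ : Unit => a) (fun _ => a) g id (fun v => g v + if v = a then 1 else 0) where
  surj := Function.surjective_id
  eq _ := rfl
  lift h _ v w hvw hv := by
    have : v = w := hvw
    exact this ▸ hv
  genus k := by
    have h1 := fibSum_inj (id : V → V) Function.injective_id
    have h2 : fibSum (fun _ : Unit => id a) 1 k = if k = a then 1 else 0 := by
      by_cases h : k = a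
      · simp [fibSum, h]
      · simp [fibSum, h, Ne.symm h]
    have h3 := h1 1 k
    have h4 := h1 g k
    simp only [id, Pi.one_apply] at h2 h3 h4 ⊢
    rw [h2]
    change _ + fibSum id 1 k = fibSum id g k + _ + 1
    omega

/-- A tube from the component `none` to the component `some c` merges them. -/
theorem IsGlue.getD [DecidableEq V] (c : V) (G : Option V → ℕ) :
    IsGlue (fun _ : Unit => (none : Option V)) (fun _ => some c) G (fun o => o.getD c)
      (fun v => G (some v) + if v = c then G none else 0) where
  surj v := ⟨some v, rfl⟩
  eq _ := rfl
  lift h hh := by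
    have key : ∀ o, h o ↔ h (some (o.getD c)) := by
      rintro (_ | v)
      · exact hh ()
      · rfl
    intro v w hvw hv
    exact (key w).2 (hvw ▸ (key v).1 hv)
  genus k := by
    have e : ∀ w : Option V → ℕ, fibSum (fun o : Option V => o.getD c) w k =
        (if k = c then w none else 0) + w (some k) := by
      intro w
      simp [fibSum, Finset.sum_filter, Fintype.sum_option, eq_comm]
    have h2 : fibSum (fun _ : Unit => (none : Option V).getD c) 1 k = if k = c then 1 else 0 := by
      by_cases h : k = c
      · simp [fibSum, h]
      · simp [fibSum, h, Ne.symm h]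
    rw [e, e, h2]
    simp only [Pi.one_apply]
    split_ifs <;> omega

end Recognition

namespace Surface

variable {I J : Type}

/-- Recognizing a surface with a tube added. -/
theorem tube_homeo (S : Surface I J) (a b : S.Comp) (S' : Surface I J) (f : S.Comp → S'.Comp)
    (H : IsGlue (fun _ : Unit => a) (fun _ => b) S.genus f S'.genus)
    (h1 : ∀ i, f (S.src i) = S'.src i) (h2 : ∀ j, f (S.tgt j) = S'.tgt j) :
    Homeo (S.tube a b) S' := by
  obtain ⟨φ, h, h'⟩ := (isGlue_glued (fun _ : Unit => a) (fun _ => b) S.genus).unique H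
  exact ⟨φ, fun i => (h _).trans (h1 i), fun j => (h _).trans (h2 j), h'⟩

/-- Adding a closed component is gluing with that component along no circle. -/
theorem glue_addClosed (S : Surface I Empty) (g : ℕ) :
    Homeo (S.glue ((cyl Empty).addClosed g)) (S.addClosed g) := by
  refine glue_homeo _ _ _ (Sum.elim some fun o : Option Empty => o.elim none Empty.elim) ?_
    (fun _ => rfl) (fun j => j.elim)
  refine IsGlue.of_isEmpty ⟨?_, ?_⟩ ?_
  · rintro (v | _ | ⟨⟨⟩⟩) (w | _ | ⟨⟨⟩⟩) h
    · exact congrArg Sum.inl (Option.some.inj h)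
    · exact absurd h (Option.some_ne_none v)
    · exact absurd h.symm (Option.some_ne_none w)
    · rfl
  · rintro (_ | c)
    · exact ⟨.inr none, rfl⟩
    · exact ⟨.inl c, rfl⟩
  · rintro (v | _ | ⟨⟨⟩⟩) <;> rfl

/-- A surface none of whose components touches both its source and its target is a composite
through the empty manifold. -/
theorem exists_glue_empty (S : Surface I J) (h : ∀ i j, S.src i ≠ S.tgt j) :
    ∃ (S₁ : Surface I Empty) (S₂ : Surface Empty J), Homeo (S₁.glue S₂) S := by
  classical
  let S₁ : Surface I Empty :=
    { Comp := {c // ¬ ∃ j, S.tgt j = c}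
      src := fun i => ⟨S.src i, fun ⟨j, hj⟩ => h i j hj.symm⟩
      tgt := Empty.elim
      genus := fun c => S.genus c }
  let S₂ : Surface Empty J :=
    { Comp := {c // ∃ j, S.tgt j = c}
      src := Empty.elim
      tgt := fun j => ⟨S.tgt j, j, rfl⟩
      genus := fun c => S.genus c }
  refine ⟨S₁, S₂, glue_homeo _ _ _ (Sum.elim Subtype.val Subtype.val)
    (IsGlue.of_isEmpty ⟨?_, ?_⟩ ?_) (fun _ => rfl) (fun _ => rfl)⟩
  · rintro (⟨v, hv⟩ | ⟨v, hv⟩) (⟨w, hw⟩ | ⟨w, hw⟩) (e : v = w)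
    · subst e; rfl
    · subst e; exact absurd hw hv
    · subst e; exact absurd hv hw
    · subst e; rfl
  · intro c
    by_cases hc : ∃ j, S.tgt j = c
    · exact ⟨.inr ⟨c, hc⟩, rfl⟩
    · exact ⟨.inl ⟨c, hc⟩, rfl⟩
  · rintro (v | v) <;> rfl

end Surface

/-! ### The linear category of cobordisms modulo the local relations -/

section Linear

variable {R : Type u} [CommRing R]

noncomputable instance : Linear R (CobL R) where
  homModule X Y := inferInstanceAs (Module R (FreeHom R X.cob Y.cob ⧸ localIdeal R X.cob Y.cob))
  smul_comp X Y Z r f g :=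
    LinearMap.congr_fun (map_smul (CobL.comp (R := R) X.cob Y.cob Z.cob) r
      (show FreeHom R X.cob Y.cob ⧸ localIdeal R X.cob Y.cob from f)) g
  comp_smul X Y Z f r g :=
    map_smul (CobL.comp (R := R) X.cob Y.cob Z.cob f) r
      (show FreeHom R Y.cob Z.cob ⧸ localIdeal R Y.cob Z.cob from g)

theorem cobLMap_smul {X Y : CobL R} (r : R) (f : X ⟶ Y) :
    cobLMap (r • f) = Polynomial.C r • cobLMap f := by
  obtain ⟨f, rfl⟩ := Submodule.Quotient.mk_surjective _ f
  exact map_smulₛₗ (freeMap R X.cob Y.cob) r f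

theorem cobLMap_homL {X Y : Cob} (S : Surface X.circles Y.circles) :
    cobLMap (S.homL R) = (frobeniusT R).surfaceMap S := freeMap_free S

theorem homL_eq {X Y : Cob} {S S' : Surface X.circles Y.circles} (h : S.Homeo S') :
    S.homL R = S'.homL R := by
  have : S.hom = S'.hom := Quotient.sound h
  unfold Surface.homL Surface.free
  rw [this]

theorem homL_comp {X Y Z : Cob} (S : Surface X.circles Y.circles)
    (S' : Surface Y.circles Z.circles) : S.homL R ≫ S'.homL R = (S.glue S').homL R := by
  change Submodule.Quotient.mk (freeComp R X Y Z (S.free R) (S'.free R)) = _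
  unfold Surface.free
  rw [freeComp_single, one_mul]
  rfl

/-- The morphisms of `CobL R` are linear combinations of surfaces. -/
theorem homL_induction {X Y : Cob} {p : ((⟨X⟩ : CobL R) ⟶ ⟨Y⟩) → Prop} (zero : p 0)
    (add : ∀ f g, p f → p g → p (f + g)) (smul : ∀ (r : R) f, p f → p (r • f))
    (homL : ∀ S : Surface X.circles Y.circles, p (S.homL R)) (f : (⟨X⟩ : CobL R) ⟶ ⟨Y⟩) : p f := by
  obtain ⟨f, rfl⟩ := Submodule.Quotient.mk_surjective _ f
  induction f using Finsupp.induction_linear with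
  | zero => exact zero
  | add f g hf hg => exact add _ _ hf hg
  | single m r =>
    induction m using Quotient.inductionOn with
    | _ S =>
      have := smul r _ (homL S)
      have e : r • S.free R = Finsupp.single S.hom r := by
        rw [Surface.free, Finsupp.smul_single, smul_eq_mul, mul_one]
      change p (Submodule.Quotient.mk (r • S.free R)) at this
      rwa [e] at this

theorem localRel_mem {X Y : Cob} {f : FreeHom R X Y} (h : LocalRel R X Y f) :
    f ∈ localIdeal R X Y :=
  Submodule.subset_span ⟨X, Y, Finsupp.single (𝟙 X) 1, f, Finsupp.single (𝟙 Y) 1, h,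
    by rw [freeComp_id_left, freeComp_id_right]⟩

theorem homL_sphere {X Y : Cob} (S : Surface X.circles Y.circles) :
    (S.addClosed 0).homL R = 0 :=
  (Submodule.Quotient.mk_eq_zero _).2 (localRel_mem (.sphere S))

theorem homL_torus {X Y : Cob} (S : Surface X.circles Y.circles) :
    (S.addClosed 1).homL R = (2 : R) • S.homL R :=
  (Submodule.Quotient.eq _).2 (localRel_mem (.torus S))

theorem homL_fourTu {X Y : Cob} (S : Surface X.circles Y.circles) (a b c d : S.Comp) :
    (S.tube a b).homL R + (S.tube c d).homL R = (S.tube a c).homL R + (S.tube b d).homL R :=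
  (Submodule.Quotient.eq _).2 (localRel_mem (.fourTu S a b c d))

/-- Neck cutting: a tube between the components `none` and `some c` is, up to the factor `2`, the
sum of a handle on the one and a handle on the other. This is the relation 4Tu in which the first
two sites lie on the one component and the last two on the other. -/
theorem homL_neck {X Y : Cob} {K : Type} [Fintype K] [DecidableEq K]
    (src : X.circles → Option K)
    (tgt : Y.circles → Option K) (G : Option K → ℕ) (c : K) :
    (2 : R) • Surface.homL R (X := X) (Y := Y) ⟨K, fun i => (src i).getD c,
        fun j => (tgt j).getD c, fun k => G (some k) + if k = c then G none else 0⟩ =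
      Surface.homL R ⟨Option K, src, tgt, fun o => G o + if o = none then 1 else 0⟩ +
      Surface.homL R ⟨Option K, src, tgt, fun o => G o + if o = some c then 1 else 0⟩ := by
  let S : Surface X.circles Y.circles := ⟨Option K, src, tgt, G⟩
  have h := homL_fourTu (R := R) S none none (some c) (some c)
  have e1 := homL_eq (R := R) (S.tube_homeo none none
    ⟨Option K, src, tgt, fun o => G o + if o = none then 1 else 0⟩ id (IsGlue.self _)
    (fun _ => rfl) (fun _ => rfl))
  have e2 := homL_eq (R := R) (S.tube_homeo (some c) (some c)
    ⟨Option K, src, tgt, fun o => G o + if o = some c then 1 else 0⟩ id (IsGlue.self _)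
    (fun _ => rfl) (fun _ => rfl))
  have e3 := homL_eq (R := R) (S.tube_homeo none (some c) ⟨K, fun i => (src i).getD c,
    fun j => (tgt j).getD c, fun k => G (some k) + if k = c then G none else 0⟩
    (fun o => o.getD c) (IsGlue.getD c G) (fun _ => rfl) (fun _ => rfl))
  rw [e1, e2, e3] at h
  rw [h, two_smul]

end Linear

/-! ### Every morphism is a sum of composites through the empty manifold -/

section Empty

variable (R : Type u) [CommRing R]

/-- The empty manifold. -/
abbrev emptyCob : CobL R := ⟨⟨Empty⟩⟩

variable {R}

/-- Every cobordism is a linear combination of composites through the empty manifold. The proof is an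
induction on the set of outgoing circles not yet cut off from the incoming ones. -/
theorem homL_mem_span_comp (h2 : IsUnit (2 : R)) {X Y : Cob}
    (S : Surface X.circles Y.circles) : S.homL R ∈ Submodule.span R
      {f : (⟨X⟩ : CobL R) ⟶ ⟨Y⟩ | ∃ (a : _ ⟶ emptyCob R) (b : emptyCob R ⟶ _), f = a ≫ b} := by
  classical
  suffices H : ∀ (P : Finset Y.circles) (S : Surface X.circles Y.circles),
      (∀ j ∉ P, ∀ i, S.src i ≠ S.tgt j) → S.homL R ∈ Submodule.span R
      {f : (⟨X⟩ : CobL R) ⟶ ⟨Y⟩ | ∃ (a : _ ⟶ emptyCob R) (b : emptyCob R ⟶ _), f = a ≫ b} from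
    H Finset.univ S fun j hj => absurd (Finset.mem_univ j) hj
  intro P
  induction P using Finset.induction_on with
  | empty =>
    intro S hS
    obtain ⟨S₁, S₂, h⟩ := S.exists_glue_empty fun i j => hS j (Finset.notMem_empty j) i
    exact Submodule.subset_span ⟨Surface.homL R (Y := ⟨Empty⟩) S₁,
      Surface.homL R (X := ⟨Empty⟩) S₂,
      ((homL_comp (Y := ⟨Empty⟩) S₁ S₂).trans (homL_eq h)).symm⟩
  | insert j P _ ih =>
    intro S hS
    -- The boundary circle `j` is cut off: it becomes the boundary of the component `none`.
    let src : X.circles → Option S.Comp := fun i => some (S.src i)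
    let tgt : Y.circles → Option S.Comp := Function.update (fun j => some (S.tgt j)) j none
    have hsep : ∀ k ∉ P, ∀ i, src i ≠ tgt k := by
      intro k hk i
      by_cases h : k = j
      · subst h; simp [src, tgt]
      · simpa [src, tgt, h] using hS k (by simp [h, hk]) i
    have e := homL_neck (R := R) src tgt (fun o => o.elim 0 S.genus) (S.tgt j)
    have e' : Surface.Homeo ⟨S.Comp, fun i => (src i).getD (S.tgt j),
        fun k => (tgt k).getD (S.tgt j), fun k => S.genus k + if k = S.tgt j then 0 else 0⟩ S := by
      refine ⟨Equiv.refl _, fun _ => rfl, fun k => ?_, fun c => by simp⟩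
      by_cases h : k = j
      · subst h; simp [tgt]
      · simp [tgt, h]
    have e'' := homL_eq (R := R) e'
    rw [← Submodule.smul_mem_iff_of_isUnit _ h2, ← e'']
    exact e ▸ Submodule.add_mem _ (ih _ hsep) (ih _ hsep)

theorem id_mem_span_comp (h2 : IsUnit (2 : R)) (X : CobL R) : 𝟙 X ∈ Submodule.span R
    {f : X ⟶ X | ∃ (a : X ⟶ emptyCob R) (b : emptyCob R ⟶ X), f = a ≫ b} :=
  homL_mem_span_comp h2 (X := X.cob) (Surface.cyl X.cob.circles)

end Empty

/-! ### Closed surfaces -/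

section Closed

variable (R : Type u) [CommRing R]

/-- A closed surface as an endomorphism of the empty manifold. -/
noncomputable def closedHom (S : Surface Empty Empty) : End (emptyCob R) :=
  Surface.homL R (X := ⟨Empty⟩) (Y := ⟨Empty⟩) S

/-- The closed connected surface of genus `g`. -/
noncomputable def closedConn (g : ℕ) : End (emptyCob R) :=
  closedHom R ((Surface.cyl Empty).addClosed g)

variable {R}

theorem closedHom_eq {K L : Type} [Fintype K] [Fintype L] {γ : K → ℕ} {δ : L → ℕ}
    {s t : Empty → K} {s' t' : Empty → L} (φ : K ≃ L) (h : ∀ k, δ (φ k) = γ k) :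
    closedHom R ⟨K, s, t, γ⟩ = closedHom R ⟨L, s', t', δ⟩ :=
  homL_eq ⟨φ, fun i => i.elim, fun j => j.elim, h⟩

theorem closedHom_addClosed (S : Surface Empty Empty) (g : ℕ) :
    closedHom R (S.addClosed g) = closedConn R g * closedHom R S :=
  ((homL_comp (X := ⟨Empty⟩) (Y := ⟨Empty⟩) (Z := ⟨Empty⟩) S _).trans
    (homL_eq (S.glue_addClosed g))).symm

theorem closedConn_zero : closedConn R 0 = 0 := homL_sphere _

theorem closedConn_one : closedConn R 1 = (2 : R) • 1 := homL_torus _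

/-- Neck cutting on a closed surface. -/
theorem closedConn_mul_add (g h : ℕ) : (2 : R) • closedConn R (g + h) =
    closedConn R (h + 1) * closedConn R g + closedConn R h * closedConn R (g + 1) := by
  have e := homL_neck (R := R) (X := ⟨Empty⟩) (Y := ⟨Empty⟩) (K := Option Empty) Empty.elim
    Empty.elim (fun o => o.elim h fun _ => g) none
  have e0 : closedConn R (g + h) = closedHom R
      ⟨Option Empty, fun i => (Empty.elim i : Option (Option Empty)).getD none,
        fun j => (Empty.elim j : Option (Option Empty)).getD none,
        fun k => g + if k = none then h else 0⟩ :=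
    closedHom_eq (Equiv.refl _) (by rintro (_ | ⟨⟨⟩⟩); rfl)
  have e1 : ∀ a b : ℕ, closedConn R b * closedConn R a = closedHom R
        ⟨Option (Option Empty), Empty.elim, Empty.elim, fun o => o.elim b fun _ => a⟩ := by
    intro a b
    refine (closedHom_addClosed _ _).symm.trans ?_
    exact closedHom_eq (Equiv.refl _) (by rintro (_ | _ | ⟨⟨⟩⟩) <;> rfl)
  rw [e0, e1, e1]
  refine e.trans (congrArg₂ _ (closedHom_eq (Equiv.refl _) ?_) (closedHom_eq (Equiv.refl _) ?_)) <;>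
    rintro (_ | _ | ⟨⟨⟩⟩) <;> rfl

theorem closedConn_two (h2 : IsUnit (2 : R)) : closedConn R 2 = 0 := by
  have e := closedConn_mul_add (R := R) 1 1
  simp only [closedConn_one, mul_smul_comm, smul_mul_assoc, one_mul, mul_one] at e
  exact (h2.smul_eq_zero).1 (left_eq_add.1 e)

/-- Up to a unit, the surface of genus three lowers the genus by two. -/
theorem closedConn_add_two (h2 : IsUnit (2 : R)) (g : ℕ) :
    (2 : R) • closedConn R (g + 2) = closedConn R 3 * closedConn R g := by
  rw [closedConn_mul_add, closedConn_two h2, zero_mul, add_zero]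

theorem closedConn_mem_adjoin (h2 : IsUnit (2 : R)) (g : ℕ) :
    closedConn R g ∈ Algebra.adjoin R {closedConn R 3} := by
  induction g using Nat.twoStepInduction with
  | zero => rw [closedConn_zero]; exact zero_mem _
  | one => rw [closedConn_one]; exact Subalgebra.smul_mem _ (one_mem _) _
  | more g h _ =>
    rw [← Subalgebra.mem_toSubmodule, ← Submodule.smul_mem_iff_of_isUnit _ h2,
      closedConn_add_two h2, Subalgebra.mem_toSubmodule]
    exact mul_mem (Algebra.subset_adjoin rfl) h

theorem closedHom_mem_adjoin (h2 : IsUnit (2 : R)) (S : Surface Empty Empty) :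
    closedHom R S ∈ Algebra.adjoin R {closedConn R 3} := by
  suffices H : ∀ (K : Type) [Fintype K] (γ : K → ℕ) (s t : Empty → K),
      closedHom R ⟨K, s, t, γ⟩ ∈ Algebra.adjoin R {closedConn R 3} from
    H S.Comp S.genus S.src S.tgt
  intro K _
  refine Fintype.induction_empty_option (P := fun K _ => ∀ (γ : K → ℕ) (s t : Empty → K),
      closedHom R ⟨K, s, t, γ⟩ ∈ Algebra.adjoin R {closedConn R 3}) ?_ ?_ ?_ K
  · intro K L _ φ ih γ s t
    let _ := Fintype.ofEquiv L φ.symm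
    rw [← closedHom_eq (R := R) (s := Empty.elim) (t := Empty.elim) φ fun k => rfl]
    exact ih (fun k => γ (φ k)) Empty.elim Empty.elim
  · intro γ s t
    rw [closedHom_eq (R := R) (s := s) (t := t) (s' := id) (t' := id) (δ := fun _ => 0)
      (Equiv.equivOfIsEmpty PEmpty Empty) fun k => k.elim]
    exact one_mem _
  · intro K _ ih γ s t
    have e : closedHom R ⟨Option K, s, t, γ⟩ = closedConn R (γ none) *
        closedHom R ⟨K, Empty.elim, Empty.elim, fun k => γ (some k)⟩ := by
      rw [← closedHom_addClosed]
      exact closedHom_eq (Equiv.refl _) (by rintro (_ | k) <;> rfl)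
    rw [e]
    exact mul_mem (closedConn_mem_adjoin h2 _) (ih _ _ _)

/-- The endomorphisms of the empty manifold are the polynomials in the closed connected surface of
genus three. -/
theorem mem_adjoin_closedConn (h2 : IsUnit (2 : R)) (f : End (emptyCob R)) :
    f ∈ Algebra.adjoin R {closedConn R 3} :=
  homL_induction (X := ⟨Empty⟩) (Y := ⟨Empty⟩)
    (p := fun f => Membership.mem (Algebra.adjoin R {closedConn R 3}) (show End (emptyCob R) from f))
    (zero_mem _) (fun _ _ => add_mem) (fun r _ h => Subalgebra.smul_mem _ h r)
    (fun S => closedHom_mem_adjoin h2 S) f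

end Closed

/-! ### The TQFT on closed surfaces -/

section ClosedTQFT

variable {R : Type u} [CommRing R]

theorem cobLMap_mul (f g : End (emptyCob R)) :
    cobLMap (f * g : End (emptyCob R)) = cobLMap f ∘ₗ cobLMap g := cobLMap_comp g f

theorem cobLMap_closedConn (g : ℕ) : cobLMap (closedConn R g) =
    (frobeniusT R).counit ((frobeniusT R).handle ^ g) • LinearMap.id := by
  refine (cobLMap_homL (X := ⟨Empty⟩) (Y := ⟨Empty⟩) _).trans ?_
  refine PiTensorProduct.ext (MultilinearMap.ext fun a => ?_)
  simp only [LinearMap.compMultilinearMap_apply, Frobenius.surfaceMap_tprod,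
    Frobenius.amp_addClosed, mul_smul, ← Finset.smul_sum]
  rw [← Frobenius.surfaceMap_tprod, (frobeniusT R).surfaceMap_cyl Empty]
  rfl

/-- The handle of `A_T` is `2 X`, and `X² = T`, so that the surface of genus three goes to `8 T`. -/
theorem counit_handle_pow_three :
    (frobeniusT R).counit ((frobeniusT R).handle ^ 3) = Polynomial.C 8 * X := by
  have h : (frobeniusT R).handle = ⟨0, 2⟩ := by
    refine QuadraticAlgebra.ext ?_ ?_ <;>
      simp [Frobenius.handle, frobeniusT, one_add_one_eq_two]
  rw [h]
  change ((⟨0, 2⟩ : AT R) ^ 3).im = _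
  simp only [pow_succ, pow_zero, one_mul, QuadraticAlgebra.im_mul, QuadraticAlgebra.re_mul]
  rw [C_ofNat]
  ring

theorem cobLMap_aeval {τ : End (emptyCob R)} (hτ : cobLMap τ = (X : R[X]) • LinearMap.id)
    (p : R[X]) : cobLMap (aeval τ p) = p • LinearMap.id := by
  have hpow : ∀ n : ℕ, cobLMap (τ ^ n) = (X ^ n : R[X]) • LinearMap.id := by
    intro n
    induction n with
    | zero => rw [pow_zero, pow_zero, one_smul]; exact cobLMap_id (emptyCob R)
    | succ n ih =>
      rw [pow_succ, cobLMap_mul, ih, hτ, LinearMap.smul_comp, LinearMap.id_comp, smul_smul,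
        pow_succ]
  induction p using Polynomial.induction_on' with
  | add p q hp hq =>
    rw [map_add, add_smul, ← hp, ← hq]
    exact cobLMap_add _ _
  | monomial n r =>
    rw [aeval_monomial, ← Algebra.smul_def, ← C_mul_X_pow_eq_monomial, mul_smul, ← hpow]
    exact cobLMap_smul _ _

/-- The algebra of endomorphisms of the empty manifold is generated by an endomorphism which the TQFT
sends to multiplication by `T`, namely an eighth of the surface of genus three. -/
theorem exists_aeval_surjective (h2 : IsUnit (2 : R)) : ∃ τ : End (emptyCob R),
    cobLMap τ = (X : R[X]) • LinearMap.id ∧ ∀ f, ∃ p : R[X], aeval τ p = f := by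
  have h8 : IsUnit (8 : R) := by
    have := h2.pow 3
    norm_num at this
    exact this
  obtain ⟨c, hc⟩ := h8.exists_left_inv
  refine ⟨c • closedConn R 3, ?_, fun f => ?_⟩
  · refine (cobLMap_smul c _).trans ?_
    rw [cobLMap_closedConn, counit_handle_pow_three, smul_smul, ← mul_assoc, ← C_mul, hc, C_1,
      one_mul]
  · have h : Algebra.adjoin R {closedConn R 3} ≤ (aeval (R := R) (c • closedConn R 3)).range := by
      refine Algebra.adjoin_le (Set.singleton_subset_iff.2 ⟨C 8 * X, ?_⟩)
      simp [← Algebra.smul_def, smul_smul, hc]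
    exact h (mem_adjoin_closedConn h2 f)

theorem smul_id_eq_zero {p : R[X]}
    (h : p • (LinearMap.id : ATpow R (emptyCob R).cob.circles →ₗ[R[X]] _) = 0) : p = 0 := by
  have := congrArg (PiTensorProduct.isEmptyEquiv Empty)
    (LinearMap.congr_fun h (PiTensorProduct.tprod R[X] Empty.elim))
  simpa using this

theorem exists_eq_smul_id
    (φ : ATpow R (emptyCob R).cob.circles →ₗ[R[X]] ATpow R (emptyCob R).cob.circles) :
    ∃ p : R[X], φ = p • LinearMap.id := by
  let e := PiTensorProduct.isEmptyEquiv (R := R[X]) (s := fun _ : Empty => AT R) Empty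
  refine ⟨e (φ (e.symm 1)), LinearMap.ext fun x => e.injective ?_⟩
  have : x = e x • e.symm 1 := by
    rw [← map_smul, smul_eq_mul, mul_one, e.symm_apply_apply]
  conv_lhs => rw [this, map_smul, map_smul, smul_eq_mul, mul_comm]
  rw [LinearMap.smul_apply, map_smul, smul_eq_mul, LinearMap.id_apply]

theorem cobLMap_empty_eq_zero (h2 : IsUnit (2 : R)) {f : emptyCob R ⟶ emptyCob R}
    (hf : cobLMap f = 0) : f = 0 := by
  obtain ⟨τ, hτ, h⟩ := exists_aeval_surjective h2
  obtain ⟨p, rfl⟩ := h f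
  rw [cobLMap_aeval hτ] at hf
  rw [smul_id_eq_zero hf, map_zero]

theorem cobLMap_empty_surjective (h2 : IsUnit (2 : R))
    (φ : ATpow R (emptyCob R).cob.circles →ₗ[R[X]] ATpow R (emptyCob R).cob.circles) :
    ∃ f : emptyCob R ⟶ emptyCob R, cobLMap f = φ := by
  obtain ⟨τ, hτ, -⟩ := exists_aeval_surjective h2
  obtain ⟨p, rfl⟩ := exists_eq_smul_id φ
  exact ⟨aeval τ p, cobLMap_aeval hτ p⟩

end ClosedTQFT

/-! ### The TQFT is an equivalence -/

section Equivalence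

variable {R : Type u} [CommRing R]

/-- By `id_mem_span_comp`, a morphism is determined by its composites with the morphisms from and to
the empty manifold. -/
theorem cobLMap_eq_zero (h2 : IsUnit (2 : R)) {M N : CobL R} {f : M ⟶ N}
    (hf : cobLMap f = 0) : f = 0 := by
  have key : ∀ (a : emptyCob R ⟶ M) (b : N ⟶ emptyCob R), a ≫ f ≫ b = 0 := fun a b =>
    cobLMap_empty_eq_zero h2 (by
      rw [cobLMap_comp, cobLMap_comp, hf, LinearMap.comp_zero, LinearMap.zero_comp])
  have key' : ∀ b : N ⟶ emptyCob R, f ≫ b = 0 := by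
    intro b
    rw [← Category.id_comp (f ≫ b)]
    refine Submodule.span_induction (p := fun q _ => q ≫ f ≫ b = 0) ?_ (by simp)
      (fun x y _ _ hx hy => by rw [Preadditive.add_comp, hx, hy, add_zero])
      (fun r x _ hx => by rw [Linear.smul_comp, hx, smul_zero]) (id_mem_span_comp h2 M)
    rintro _ ⟨c, d, rfl⟩
    rw [Category.assoc, key, Limits.comp_zero]
  rw [← Category.comp_id f]
  refine Submodule.span_induction (p := fun q _ => f ≫ q = 0) ?_ (by simp)
    (fun x y _ _ hx hy => by rw [Preadditive.comp_add, hx, hy, add_zero])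
    (fun r x _ hx => by rw [Linear.comp_smul, hx, smul_zero]) (id_mem_span_comp h2 N)
  rintro _ ⟨c, d, rfl⟩
  rw [← Category.assoc, key', Limits.zero_comp]

theorem cobLMap_injective (h2 : IsUnit (2 : R)) {M N : CobL R} {f g : M ⟶ N}
    (h : cobLMap f = cobLMap g) : f = g := by
  have e : cobLMap (f + (-1 : R) • g) = 0 := by
    have e1 : (1 : R[X]) + C (-1) = 0 := by rw [map_neg, map_one, add_neg_cancel]
    have e2 := add_smul (1 : R[X]) (C (-1)) (cobLMap g)
    rw [e1, zero_smul, one_smul] at e2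
    rw [cobLMap_add, cobLMap_smul, h, ← e2]
  have e' := cobLMap_eq_zero h2 e
  rwa [neg_smul, one_smul, ← sub_eq_add_neg, sub_eq_zero] at e'

/-- By `id_mem_span_comp`, a linear map is a sum of linear maps which factor through the
value at the empty manifold, first on the side of the target, then on that of the source. -/
theorem cobLMap_surjective (h2 : IsUnit (2 : R)) {M N : CobL R}
    (φ : ATpow R M.cob.circles →ₗ[R[X]] ATpow R N.cob.circles) :
    ∃ f : M ⟶ N, cobLMap f = φ := by
  have key : ∀ ψ : ATpow R (emptyCob R).cob.circles →ₗ[R[X]] ATpow R N.cob.circles,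
      ∃ f : emptyCob R ⟶ N, cobLMap f = ψ := by
    intro ψ
    rw [← LinearMap.id_comp ψ, ← cobLMap_id N]
    refine Submodule.span_induction (p := fun q _ => ∃ f : emptyCob R ⟶ N,
      cobLMap f = cobLMap q ∘ₗ ψ) ?_ ⟨0, by rw [cobLMap_zero, cobLMap_zero]; rfl⟩ ?_ ?_
      (id_mem_span_comp h2 N)
    · rintro _ ⟨a, b, rfl⟩
      obtain ⟨f, hf⟩ := cobLMap_empty_surjective h2 (cobLMap a ∘ₗ ψ)
      exact ⟨f ≫ b, by rw [cobLMap_comp, cobLMap_comp, hf]; rfl⟩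
    · rintro x y _ _ ⟨f, hf⟩ ⟨g, hg⟩
      exact ⟨f + g, by rw [cobLMap_add, cobLMap_add, hf, hg, LinearMap.add_comp]⟩
    · rintro r x _ ⟨f, hf⟩
      exact ⟨r • f, by rw [cobLMap_smul, cobLMap_smul, hf, LinearMap.smul_comp]⟩
  rw [← LinearMap.comp_id φ, ← cobLMap_id M]
  refine Submodule.span_induction (p := fun q _ => ∃ f : M ⟶ N,
    cobLMap f = φ ∘ₗ cobLMap q) ?_ ⟨0, by simp [cobLMap_zero]⟩ ?_ ?_
      (id_mem_span_comp h2 M)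
  · rintro _ ⟨a, b, rfl⟩
    obtain ⟨f, hf⟩ := key (φ ∘ₗ cobLMap b)
    exact ⟨a ≫ f, by rw [cobLMap_comp, cobLMap_comp, hf]; rfl⟩
  · rintro x y _ _ ⟨f, hf⟩ ⟨g, hg⟩
    exact ⟨f + g, by rw [cobLMap_add, cobLMap_add, hf, hg, LinearMap.comp_add]⟩
  · rintro r x _ ⟨f, hf⟩
    exact ⟨r • f, by rw [cobLMap_smul, cobLMap_smul, hf, LinearMap.comp_smul]⟩

theorem matMap_single {ι κ : Type} [Fintype ι] [DecidableEq ι] {M : ι → CobL R} {N : κ → CobL R}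
    (f : ∀ i j, M i ⟶ N j) (i : ι) (j : κ) :
    LinearMap.proj j ∘ₗ matMap f ∘ₗ LinearMap.single R[X] _ i = cobLMap (f i j) := by
  refine LinearMap.ext fun x => ?_
  change (∑ i', cobLMap (f i' j) ∘ₗ LinearMap.proj i') (Pi.single i x) = _
  rw [LinearMap.sum_apply, Finset.sum_eq_single i]
  · simp
  · intro k _ hk
    simp [Pi.single_eq_of_ne hk]
  · exact fun h => absurd (Finset.mem_univ i) h

theorem FT_faithful (h2 : IsUnit (2 : R)) : (FT R).Faithful where
  map_injective {M N} f g h := by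
    classical
    have h' : matMap f = matMap g := congrArg (fun q => q.hom.hom) h
    funext i j
    exact cobLMap_injective h2 (by rw [← matMap_single f, ← matMap_single g, h'])

theorem FT_full (h2 : IsUnit (2 : R)) : (FT R).Full where
  map_surjective {M N} φ := by
    classical
    let ψ : (∀ i, ATpow R (M.X i).cob.circles) →ₗ[R[X]] ∀ j, ATpow R (N.X j).cob.circles :=
      φ.hom.hom
    choose f hf using fun i j => cobLMap_surjective h2 (M := M.X i) (N := N.X j)
      (LinearMap.proj j ∘ₗ ψ ∘ₗ
        LinearMap.single R[X] (fun i => ATpow R (M.X i).cob.circles) i)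
    refine ⟨f, ObjectProperty.hom_ext _ (ModuleCat.hom_ext ?_)⟩
    change matMap f = ψ
    refine LinearMap.pi_ext' fun i => LinearMap.ext fun x => funext fun j => ?_
    have := LinearMap.congr_fun ((matMap_single f i j).trans (hf i j)) x
    exact this

theorem FT_essSurj : (FT R).EssSurj where
  mem_essImage M := by
    obtain ⟨M, hM, hM'⟩ := M
    -- Over the zero ring the chosen basis is not known to be finite, but the module is zero.
    obtain ⟨n, ⟨b⟩⟩ : ∃ n, Nonempty (Module.Basis (Fin n) R[X] M) := by
      rcases subsingleton_or_nontrivial R[X] with h | h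
      · have := Module.subsingleton R[X] M
        exact ⟨0, ⟨Module.Basis.empty M⟩⟩
      · exact ⟨_, ⟨(Module.Free.chooseBasis R[X] M).reindex (Fintype.equivFin _)⟩⟩
    let e : (∀ _ : Fin n, ATpow R (emptyCob R).cob.circles) ≃ₗ[R[X]] M :=
      (LinearEquiv.piCongrRight fun _ => PiTensorProduct.isEmptyEquiv Empty).trans b.equivFun.symm
    exact ⟨⟨Fin n, fun _ => emptyCob R⟩, ⟨ObjectProperty.isoMk _ e.toModuleIso⟩⟩

theorem FT_isEquivalence (h2 : IsUnit (2 : R)) : (FT R).IsEquivalence where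
  faithful := FT_faithful h2
  full := FT_full h2
  essSurj := FT_essSurj

end Equivalence

end GeomLink

theorem theorem6p1 {R : Type u} [CommRing R] (h2 : IsUnit (2 : R))
    {𝒜 : Type w} [Category.{v} 𝒜] [Preadditive 𝒜]
    (F : Mat_ (GeomLink.CobL R) ⥤ 𝒜) [F.Additive] :
    ∃ (G : GeomLink.FreeMod R[X] ⥤ 𝒜) (_ : G.Additive),
      Nonempty (GeomLink.FT R ⋙ G ≅ F) ∧
      (∀ G' : GeomLink.FreeMod R[X] ⥤ 𝒜, Nonempty (GeomLink.FT R ⋙ G' ≅ F) → Nonempty (G' ≅ G)) ∧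
      (∀ D : GeomLink.LinkDiagram,
        Nonempty ((F.mapHomologicalComplex _).obj (D.complex R) ≅
          (G.mapHomologicalComplex _).obj
            (((GeomLink.FT R).mapHomologicalComplex _).obj (D.complex R)))) ∧
      ∀ D D' : GeomLink.LinkDiagram,
        Nonempty (HomotopyEquiv (((GeomLink.FT R).mapHomologicalComplex _).obj (D.complex R))
          (((GeomLink.FT R).mapHomologicalComplex _).obj (D'.complex R))) →
        Nonempty (HomotopyEquiv ((F.mapHomologicalComplex _).obj (D.complex R))
          ((F.mapHomologicalComplex _).obj (D'.complex R))) := by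
  have := GeomLink.FT_isEquivalence h2
  let e := (GeomLink.FT R).asEquivalence
  have : e.functor.Additive := inferInstanceAs (GeomLink.FT R).Additive
  have : e.inverse.Additive := e.inverse_additive
  let G := e.inverse ⋙ F
  let α : GeomLink.FT R ⋙ G ≅ F := e.funInvIdAssoc F
  have iso (D : GeomLink.LinkDiagram) : (F.mapHomologicalComplex _).obj (D.complex R) ≅
      (G.mapHomologicalComplex _).obj
        (((GeomLink.FT R).mapHomologicalComplex _).obj (D.complex R)) :=
    (NatIso.mapHomologicalComplex α.symm _).app (D.complex R)
  refine ⟨G, inferInstance, ⟨α⟩, fun G' ⟨β⟩ => ?_, fun D => ⟨iso D⟩, fun D D' ⟨h⟩ => ?_⟩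
  · exact ⟨(e.invFunIdAssoc G').symm ≪≫ Functor.isoWhiskerLeft e.inverse β⟩
  · exact ⟨(HomotopyEquiv.ofIso (iso D)).trans
      ((G.mapHomotopyEquiv h).trans (HomotopyEquiv.ofIso (iso D').symm))⟩
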